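/- Let $(\Gamma,S)$ be a Coxeter system with $S$ finite, so $\Gamma=\langle s\in S\mid s^2=1,\ (st)^{m_{st}}=1 \text{ for } s\ne t\rangle$ with $m_{st}\in\{2,3,\dots,+\infty\}$, and assume that $\Gamma$ is Gromov hyperbolic. Let $G$ be the Cayley graph of $(\Gamma,S)$, let $|\cdot|$ be the word length, and let $\partial\Gamma$ be the boundary at infinity, that is, the set of geodesic rays of $G$ up to bounded distance, with its usual topology and the canonical action of $\Gamma$. A metric $d$ on $\partial\Gamma$ is visual if there are $a>1$, $C\ge 1$ such that $C^{-1}a^{-\ell}\le d(z,w)\le Ca^{-\ell}$ for all $z\neq w$, where $\ell$ is the distance in $G$ from the identity to a bi-infinite geodesic from $z$ to $w$. For a set $E$ of vertices of $G$ (for example a subgroup), $\partial E\subset\partial\Gamma$ denotes its limit set. A parabolic subgroup is a conjugate of a subgroup generated by a non-empty subset of $S$; a parabolic limit set is a non-empty set $\partial P$ with $P$ a parabolic subgroup. For $s\in S$ the wall $M_s$ is the set of edges of $G$ invariant under left multiplication by $s$, and it bounds the half-spaces with vertex sets $\{g: |sg|=|g|+1\}$ and $\{g : |sg|=|g|-1\}$.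 A wall is a translate $M=g(M_s)$, $g\in\Gamma$; it bounds the translates by $g$ of these half-spaces, and $gsg^{-1}$ is the reflection along it. A wall cuts $F\subset\partial\Gamma$ if $F$ meets the limit sets of both half-spaces that it bounds. (A) Let $F\subset\partial\Gamma$ contain at least two points, assume that $F$ is invariant under every reflection whose wall cuts $F$, and let $P$ be the subgroup generated by these reflections. Then $P$ is a parabolic subgroup, $\overline F=\partial P$, and $P$ is the stabilizer $\{g\in\Gamma: gF=F\}$ of $F$ in $\Gamma$. (B) Let $\sim$ be a $\Gamma$-invariant equivalence relation on $\partial\Gamma$ whose cosets (equivalence classes) are connected. Then: 1. The closure of each coset is either a point or a parabolic limit set. 2. Let $d$ be a visual metric on $\partial\Gamma$, let $F$ be a path-connected coset containing more than one point, and let $P$ be a parabolic subgroup with $\overline F=\partial P$. Then for every $\epsilon>0$ and every path $\eta:[0,1]\to\partial P$ there is a path $\eta':[0,1]\to F$ such that $\max_{t\in[0,1]}d(\eta(t),\eta'(t))<\epsilon$. -/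

import Mathlib

open Filter Topology
open scoped Pointwise unitInterval

namespace CoxeterSystem

variable {B Γ : Type*} [Group Γ] {M : CoxeterMatrix B} (cs : CoxeterSystem M Γ)

/-! ### The Cayley graph with its word metric, and hyperbolicity -/

/-- The distance between two vertices of the Cayley graph of `(Γ, S)`: edges join `g` to `g * s`. -/
noncomputable def wordDist (x y : Γ) : ℕ := cs.length (x⁻¹ * y)

theorem wordDist_self (x : Γ) : cs.wordDist x x = 0 := by simp [wordDist]

theorem wordDist_comm (x y : Γ) : cs.wordDist x y = cs.wordDist y x := by
  unfold wordDist
  rw [← cs.length_inv]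
  simp

theorem wordDist_triangle (x y z : Γ) :
    cs.wordDist x z ≤ cs.wordDist x y + cs.wordDist y z := by
  unfold wordDist
  have h := cs.length_mul_le (x⁻¹ * y) (y⁻¹ * z)
  simpa [mul_assoc] using h

theorem wordDist_mul_left (g x y : Γ) : cs.wordDist (g * x) (g * y) = cs.wordDist x y := by
  simp [wordDist, mul_assoc]

/-- `p 0, p 1, …, p |x - y|` are the successive vertices of a geodesic segment from `x` to `y`
in the Cayley graph (the other values of `p` are irrelevant). -/
def IsGeodesicSegment (x y : Γ) (p : ℕ → Γ) : Prop :=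
  p 0 = x ∧ p (cs.wordDist x y) = y ∧
    ∀ i j, i ≤ j → j ≤ cs.wordDist x y → cs.wordDist (p i) (p j) = j - i

/-- `(Γ, S)` is Gromov hyperbolic: geodesic triangles of the Cayley graph are uniformly thin. -/
def IsGromovHyperbolic : Prop :=
  ∃ δ : ℕ, ∀ (x y z : Γ) (p q r : ℕ → Γ),
    cs.IsGeodesicSegment x y p → cs.IsGeodesicSegment y z q → cs.IsGeodesicSegment z x r →
    ∀ i ≤ cs.wordDist x y,
      (∃ j ≤ cs.wordDist y z, cs.wordDist (p i) (q j) ≤ δ) ∨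
      (∃ k ≤ cs.wordDist z x, cs.wordDist (p i) (r k) ≤ δ)

/-! ### The boundary at infinity -/

/-- Geodesic rays of the Cayley graph, starting at any vertex, given by their successive vertices. -/
@[ext]
structure GeodesicRay where
  vertex : ℕ → Γ
  isGeodesic : ∀ i j, i ≤ j → cs.wordDist (vertex i) (vertex j) = j - i

/-- The topology of uniform convergence on compact sets, that is, of pointwise convergence, the
vertex set `Γ` being discrete. -/
instance : TopologicalSpace (cs.GeodesicRay) :=
  TopologicalSpace.induced GeodesicRay.vertex (@Pi.topologicalSpace ℕ (fun _ => Γ) fun _ => ⊥)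

/-- Two rays are asymptotic when they stay at bounded distance from each other. -/
def rayIsAsymptotic : Setoid (cs.GeodesicRay) where
  r c c' := ∃ K : ℕ, ∀ n, cs.wordDist (c.vertex n) (c'.vertex n) ≤ K
  iseqv :=
    { refl := fun _ => ⟨0, fun _ => (cs.wordDist_self _).le⟩
      symm := fun ⟨K, hK⟩ => ⟨K, fun n => (cs.wordDist_comm _ _).le.trans (hK n)⟩
      trans := fun ⟨K, hK⟩ ⟨L, hL⟩ =>
        ⟨K + L, fun n => (cs.wordDist_triangle _ _ _).trans (add_le_add (hK n) (hL n))⟩ }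

/-- The boundary at infinity `∂Γ`: asymptoty classes of geodesic rays. -/
def Boundary : Type _ := Quotient cs.rayIsAsymptotic

/-- The boundary carries the quotient topology. -/
instance : TopologicalSpace cs.Boundary :=
  inferInstanceAs (TopologicalSpace (Quotient cs.rayIsAsymptotic))

/-- The endpoint at infinity of a ray. -/
def endpoint (c : cs.GeodesicRay) : cs.Boundary := Quotient.mk cs.rayIsAsymptotic c

/-- Left translation of a ray. -/
def translate (g : Γ) (c : cs.GeodesicRay) : cs.GeodesicRay :=
  ⟨fun n => g * c.vertex n, fun i j h => by rw [cs.wordDist_mul_left]; exact c.isGeodesic i j h⟩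

/-- The canonical action of `Γ` on `∂Γ`. -/
instance : MulAction Γ cs.Boundary where
  smul g := Quotient.map (cs.translate g) fun _ _ ⟨K, hK⟩ =>
    ⟨K, fun n => (cs.wordDist_mul_left _ _ _).le.trans (hK n)⟩
  one_smul z := by
    induction z using Quotient.inductionOn with
    | h c => exact congrArg cs.endpoint (GeodesicRay.ext (funext fun n => one_mul _))
  mul_smul g h z := by
    induction z using Quotient.inductionOn with
    | h c => exact congrArg cs.endpoint (GeodesicRay.ext (funext fun n => mul_assoc _ _ _))

theorem smul_endpoint (g : Γ) (c : cs.GeodesicRay) :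
    g • cs.endpoint c = cs.endpoint (cs.translate g c) := rfl

/-! ### Visual metrics -/

/-- `c` is the sequence of vertices of a bi-infinite geodesic of the Cayley graph. -/
def IsGeodesicLine (c : ℤ → Γ) : Prop :=
  ∀ i j, i ≤ j → (cs.wordDist (c i) (c j) : ℤ) = j - i

/-- The bi-infinite geodesic `c` goes from the boundary point `z` to the boundary point `w`. -/
def Joins (c : ℤ → Γ) (z w : cs.Boundary) : Prop :=
  cs.IsGeodesicLine c ∧
    (∃ ρ : cs.GeodesicRay, (∀ n : ℕ, ρ.vertex n = c (-(n : ℤ))) ∧ cs.endpoint ρ = z) ∧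
    ∃ ρ : cs.GeodesicRay, (∀ n : ℕ, ρ.vertex n = c n) ∧ cs.endpoint ρ = w

/-- The distance from the identity to a bi-infinite geodesic. -/
noncomputable def distToLine (c : ℤ → Γ) : ℕ := sInf (Set.range fun n => cs.wordDist 1 (c n))

/-- `d` is a visual metric on `∂Γ`: a metric such that, for some `a > 1` and `C ≥ 1`, one has
`C⁻¹ a ^ (-ℓ) ≤ d z w ≤ C a ^ (-ℓ)`, where `ℓ` is the distance from the identity to a
geodesic `(z, w)`. -/
structure IsVisualMetric (d : cs.Boundary → cs.Boundary → ℝ) : Prop where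
  eq_zero_iff : ∀ z w, d z w = 0 ↔ z = w
  symm : ∀ z w, d z w = d w z
  triangle : ∀ x y z, d x z ≤ d x y + d y z
  visual : ∃ a C : ℝ, 1 < a ∧ 1 ≤ C ∧ ∀ (z w : cs.Boundary) (c : ℤ → Γ), cs.Joins c z w →
    C⁻¹ * (a ^ cs.distToLine c)⁻¹ ≤ d z w ∧ d z w ≤ C * (a ^ cs.distToLine c)⁻¹

/-! ### Limit sets, parabolic subgroups, walls -/

/-- The Gromov product of two vertices based at the identity. -/
noncomputable def gromovProduct (x y : Γ) : ℝ :=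
  ((cs.wordDist 1 x : ℝ) + cs.wordDist 1 y - cs.wordDist x y) / 2

/-- The sequence of vertices `x n` converges to the point `z` of the boundary. -/
def ConvergesTo (x : ℕ → Γ) (z : cs.Boundary) : Prop :=
  ∃ c : cs.GeodesicRay, cs.endpoint c = z ∧
    Tendsto (fun k : ℕ × ℕ => cs.gromovProduct (x k.1) (c.vertex k.2)) atTop atTop

/-- The limit set in `∂Γ` of a set of vertices. -/
def limitSet (E : Set Γ) : Set cs.Boundary :=
  {z | ∃ x : ℕ → Γ, (∀ n, x n ∈ E) ∧ cs.ConvergesTo x z}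

/-- The special subgroup generated by the simple reflections indexed by `J`. -/
def specialSubgroup (J : Set B) : Subgroup Γ := Subgroup.closure (cs.simple '' J)

/-- Parabolic subgroups: the conjugates of the special subgroups `Γ_J`, `J ≠ ∅`. -/
def IsParabolic (P : Subgroup Γ) : Prop :=
  ∃ (J : Set B) (g : Γ), J.Nonempty ∧ P = (cs.specialSubgroup J).map (MulAut.conj g).toMonoidHom

/-- Parabolic limit sets: the non-empty limit sets of parabolic subgroups. -/
def IsParabolicLimitSet (A : Set cs.Boundary) : Prop :=
  A.Nonempty ∧ ∃ P : Subgroup Γ, cs.IsParabolic P ∧ A = cs.limitSet P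

/-- The vertices of the half-space `H₋(M_s)`, for the simple reflection `s` of index `i`. -/
def negHalfSpace (i : B) : Set Γ := {g | cs.length (cs.simple i * g) = cs.length g + 1}

/-- The vertices of the half-space `H₊(M_s)`, for the simple reflection `s` of index `i`. -/
def posHalfSpace (i : B) : Set Γ := {g | cs.length (cs.simple i * g) + 1 = cs.length g}

/-- The wall `g(M_s)`, `s` being the simple reflection of index `i`, cuts `F`: the set `F` meets
the limit sets of both half-spaces `g H₋(M_s)` and `g H₊(M_s)` bounded by the wall. -/
def WallCuts (g : Γ) (i : B) (F : Set cs.Boundary) : Prop :=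
  (F ∩ cs.limitSet (g • cs.negHalfSpace i)).Nonempty ∧
    (F ∩ cs.limitSet (g • cs.posHalfSpace i)).Nonempty

/-- The reflection along the wall `g(M_s)`, `s` being the simple reflection of index `i`. -/
def wallReflection (g : Γ) (i : B) : Γ := g * cs.simple i * g⁻¹

/-- The subgroup generated by the reflections whose walls cut `F`. -/
def cuttingSubgroup (F : Set cs.Boundary) : Subgroup Γ :=
  Subgroup.closure {t | ∃ (g : Γ) (i : B), cs.WallCuts g i F ∧ t = cs.wallReflection g i}

end CoxeterSystem

/-!
The proof rests on two properties of the half-spaces of `Γ`. They are convex, since reflecting one of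
two vertices separated by a wall brings them closer (`wordDist_reflection_mul_lt`; this is the
exchange property, obtained from the parity cocycle `side`, which tells on which side of a wall a
vertex lies). And every boundary point lies strictly inside half-spaces arbitrarily far from the
identity (`IsThin.exists_halfSpace_far`): a long initial segment of a ray crosses more walls than
there are walls near its two ends, so some wall crossing it is far from both ends. Limit sets of
convex sets are closed, because a ray to a limit point of a convex set stays near this set
(`IsThin.exists_near_of_mem_limitSet`). Hence the limit sets of far half-spaces serve as small
neighbourhoods of boundary points, and no other description of the topology is needed; they are
also small for every visual metric.

For a set `F` of boundary points invariant under the reflections whose walls cut it, let the hull of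
`F` be the set of vertices contained in no half-space whose limit set misses `F`. It is convex, it
contains the bi-infinite geodesics joining points of `F`, and each of its edges crosses a wall which
cuts `F`. So the group `P` generated by the cutting reflections acts transitively on it, and the hull
is a coset `x Γ_J` with `P = x Γ_J x⁻¹`. An element preserving `F` preserves the hull, hence lies
in `P`. The closure of `F` is the limit set of the hull: given a limit point and a small half-space
around it, some `P`-translate of a geodesic joining two points of `F` meets this half-space, and then
one of its ends, a point of `F`, is in the limit set of the half-space.

A connected coset cut by a wall meets the intersection of the limit sets of the two sides, which the
reflection fixes pointwise (`IsThin.smul_eq_of_mem_limitSet`), so the reflection preserves the coset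
and the above applies. Finally, a path in a path-connected coset `F` with its ends strictly inside a
half-space can be folded into the limit set of this half-space without leaving `F`
(`IsThin.joinedIn_inter_limitSet`). So nearby points of `F` are joined by small paths in `F`, and a
path in the closure of `F` is approximated by subdividing it.
-/

/-! ### Concatenation of paths -/

/-- Concatenation of paths `γ k` from `z k` to `z (k + 1)`, parametrized by `[k, k + 1]`. -/
theorem exists_continuous_of_forall_joinedIn {X : Type*} [TopologicalSpace X] (z : ℕ → X)
    (V : ℕ → Set X) (h : ∀ k, JoinedIn (V k) (z k) (z (k + 1))) (n : ℕ) :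
    ∃ f : ℝ → X, Continuous f ∧ (∀ x, (n : ℝ) ≤ x → f x = z n) ∧
      ∀ k < n, ∀ x : ℝ, k ≤ x → x ≤ k + 1 → f x ∈ V k := by
  induction n with
  | zero => exact ⟨fun _ => z 0, continuous_const, fun _ _ => rfl, fun k hk => by omega⟩
  | succ n ih =>
    obtain ⟨f, hf, hfn, hfV⟩ := ih
    obtain ⟨γ, hγ⟩ := h n
    refine ⟨fun x => if x ≤ n then f x else γ.extend (x - n), ?_, fun x hx => ?_,
      fun k hk x h1 h2 => ?_⟩
    · refine hf.if_le (γ.continuous_extend.comp (continuous_id.sub continuous_const))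
        continuous_id continuous_const fun x hx => ?_
      replace hx : x = n := hx
      simp [hx, hfn n le_rfl]
    · push_cast at hx
      simp only
      rw [if_neg (by linarith), γ.extend_of_one_le (by linarith)]
    · have hγ' : ∀ s, γ.extend s ∈ V n := fun s => by
        have : γ.extend s ∈ Set.range γ := by rw [← γ.extend_range]; exact Set.mem_range_self s
        obtain ⟨s', hs'⟩ := this
        rw [← hs']
        exact hγ s'
      simp only
      rcases Nat.lt_succ_iff_lt_or_eq.1 hk with hk | rfl
      · have : ((k : ℝ) + 1) ≤ n := by exact_mod_cast hk
        rw [if_pos (by linarith)]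
        exact hfV k hk x h1 h2
      · split_ifs with h3
        · have : x = k := le_antisymm h3 h1
          rw [this, hfn k le_rfl]
          have := hγ 0
          rwa [γ.source] at this
        · exact hγ' _

namespace CoxeterSystem

variable {B Γ : Type*} [Group Γ] {M : CoxeterMatrix B} (cs : CoxeterSystem M Γ)

/-! ### The two sides of a wall -/

open scoped Classical in
/-- The transformation `(t, ε) ↦ (s t s⁻¹, ε + [t = s])` of `Γ × ℤ/2` attached to the simple
reflection `s` of index `i`. -/
noncomputable def inversionStep (i : B) : Function.End (Γ × ZMod 2) :=
  fun p => (cs.simple i * p.1 * cs.simple i, p.2 + if p.1 = cs.simple i then 1 else 0)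

open scoped Classical in
/-- The powers of the product of two steps. The reflections counted along the way are the
`(s_i s_j)⁻ⁿ s_j`, which is periodic in `n` of period `m_{ij}`. -/
theorem inversionStep_mul_pow_apply (i j : B) (k : ℕ) (t : Γ) (ε : ZMod 2) :
    ((cs.inversionStep i * cs.inversionStep j) ^ k) (t, ε) =
      ((cs.simple i * cs.simple j) ^ k * t * ((cs.simple i * cs.simple j) ^ k)⁻¹,
        ε + ∑ n ∈ Finset.range (2 * k),
          if t = ((cs.simple i * cs.simple j) ^ n)⁻¹ * cs.simple j then 1 else 0) := by
  induction k with
  | zero => simp; rfl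
  | succ k ih =>
    set g := cs.simple i * cs.simple j with hg
    -- conjugating by `s_j` inverts the rotation `g = s_i s_j`
    have hj : ∀ n : ℕ, cs.simple j * g ^ n = (g ^ n)⁻¹ * cs.simple j := by
      intro n
      have h : SemiconjBy (cs.simple j) g g⁻¹ := by simp [SemiconjBy, hg, mul_assoc]
      rw [← inv_pow]
      exact h.pow_right n
    rw [pow_succ', show ((cs.inversionStep i * cs.inversionStep j) *
      (cs.inversionStep i * cs.inversionStep j) ^ k) (t, ε) = cs.inversionStep i
        (cs.inversionStep j (((cs.inversionStep i * cs.inversionStep j) ^ k) (t, ε))) from rfl, ih]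
    have e1 : (g ^ k * t * (g ^ k)⁻¹ = cs.simple j) ↔ t = (g ^ (2 * k))⁻¹ * cs.simple j := by
      rw [mul_inv_eq_iff_eq_mul, hj, two_mul, pow_add, mul_inv_rev, mul_assoc (g ^ k)⁻¹,
        ← eq_inv_mul_iff_mul_eq]
    have e2 : (cs.simple j * (g ^ k * t * (g ^ k)⁻¹) * cs.simple j = cs.simple i) ↔
        t = (g ^ (2 * k + 1))⁻¹ * cs.simple j := by
      have h3 : (g ^ (2 * k + 1))⁻¹ * cs.simple j
          = (g ^ k)⁻¹ * (cs.simple j * cs.simple i * cs.simple j) * g ^ k := by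
        rw [mul_assoc, mul_assoc _ _ (g ^ k), hj, show 2 * k + 1 = k + 1 + k by omega, pow_add,
          pow_add, pow_one, mul_inv_rev, mul_inv_rev]
        have : (cs.simple j * cs.simple i) = g⁻¹ := by simp [hg]
        rw [this]
        simp only [mul_assoc]
      rw [h3]
      constructor
      · intro h
        rw [← h]
        simp [mul_assoc]
      · rintro rfl
        simp [mul_assoc]
    simp only [inversionStep]
    rw [show 2 * (k + 1) = 2 * k + 1 + 1 by ring, Finset.sum_range_succ, Finset.sum_range_succ]
    refine Prod.ext ?_ ?_
    · simp [hg, mul_assoc, pow_succ']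
    · simp only [e1, e2, add_assoc]

theorem isLiftable_inversionStep : M.IsLiftable cs.inversionStep := by
  classical
  intro i j
  funext ⟨t, ε⟩
  rw [inversionStep_mul_pow_apply]
  refine Prod.ext ?_ ?_
  · simp; rfl
  · show _ = ε
    -- the indices `n` and `n + m_{ij}` give the same reflection, so the sum is even
    rw [two_mul, Finset.sum_range_add]
    simp only [pow_add, cs.simple_mul_simple_pow, one_mul]
    rw [CharTwo.add_self_eq_zero, add_zero]

/-- The action of `Γ` on `Γ × ℤ/2` which on the reflections counts, modulo two, the inversions. -/
noncomputable def inversionHom : Γ →* Function.End (Γ × ZMod 2) :=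
  cs.lift ⟨cs.inversionStep, cs.isLiftable_inversionStep⟩

/-- The side of the wall of the reflection `t` on which the vertex `x` lies: `0` for the side of the
identity, `1` for the other one. -/
noncomputable def side (t x : Γ) : ZMod 2 := (cs.inversionHom x⁻¹ (t, 0)).2

theorem inversionHom_simple (i : B) : cs.inversionHom (cs.simple i) = cs.inversionStep i :=
  cs.lift_apply_simple cs.isLiftable_inversionStep i

theorem inversionHom_apply (w t : Γ) (ε : ZMod 2) :
    cs.inversionHom w (t, ε) = (w * t * w⁻¹, ε + cs.side t w⁻¹) := by
  classical
  unfold side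
  rw [inv_inv]
  induction w using cs.simple_induction_left generalizing ε with
  | one =>
    rw [map_one]
    exact Prod.ext (by simp; rfl) (add_zero ε).symm
  | mul_simple_left w i ih =>
    have h : ∀ p, cs.inversionHom (cs.simple i * w) p
        = cs.inversionStep i (cs.inversionHom w p) := by
      intro p
      rw [map_mul, inversionHom_simple]
      rfl
    rw [h, h, ih, ih 0]
    simp [inversionStep, mul_assoc, add_assoc]

theorem side_one (t : Γ) : cs.side t 1 = 0 := by
  unfold side
  simp; rfl

theorem side_mul (t x y : Γ) :
    cs.side t (x * y) = cs.side t x + cs.side (x⁻¹ * t * x) y := by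
  have h : cs.side t (x * y) = (cs.inversionHom y⁻¹ (cs.inversionHom x⁻¹ (t, 0))).2 := by
    unfold side
    rw [mul_inv_rev, map_mul]
    rfl
  rw [h, inversionHom_apply, inversionHom_apply]
  simp

open scoped Classical in
theorem side_simple (t : Γ) (i : B) :
    cs.side t (cs.simple i) = if t = cs.simple i then 1 else 0 := by
  unfold side
  rw [inv_simple, inversionHom_simple]
  simp [inversionStep]

/-- A reflection exchanges the two sides of its wall. -/
theorem side_reflection_mul {t : Γ} (ht : cs.IsReflection t) (x : Γ) :
    cs.side t (t * x) = cs.side t x + 1 := by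
  have key : cs.side t t = 1 := by
    obtain ⟨g, i, rfl⟩ := ht
    have h0 := cs.side_mul (g * cs.simple i * g⁻¹) g g⁻¹
    have h1 := cs.side_mul (g * cs.simple i * g⁻¹) g (cs.simple i * g⁻¹)
    have h2 := cs.side_mul (cs.simple i) (cs.simple i) g⁻¹
    rw [side_simple, if_pos rfl] at h2
    have e : g⁻¹ * (g * cs.simple i * g⁻¹) * g = cs.simple i := by group
    rw [e, mul_inv_cancel, side_one] at h0
    rw [e, ← mul_assoc] at h1
    rw [inv_mul_cancel, one_mul] at h2
    rw [h1, h2, add_left_comm, ← h0, add_zero]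
  rw [side_mul, key, inv_mul_cancel, one_mul, add_comm]

theorem mem_leftInvSeq_of_side_ne_zero (ω : List B) {t : Γ} (h : cs.side t (cs.wordProd ω) ≠ 0) :
    t ∈ cs.leftInvSeq ω := by
  classical
  induction ω using List.reverseRecOn with
  | nil => simp [side_one] at h
  | append_singleton ω i ih =>
    rw [← List.concat_eq_append] at h ⊢
    rw [leftInvSeq_concat, List.concat_eq_append, List.mem_append, List.mem_singleton]
    rw [wordProd_concat, side_mul, side_simple] at h
    by_cases h0 : cs.side t (cs.wordProd ω) = 0
    · right
      by_contra h1
      rw [h0, if_neg, add_zero] at h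
      · exact h rfl
      · intro h2
        apply h1
        rw [← h2]
        simp [mul_assoc]
    · exact Or.inl (ih h0)

theorem length_mul_lt_of_side_ne_zero {t x : Γ} (h : cs.side t x ≠ 0) :
    cs.length (t * x) < cs.length x := by
  obtain ⟨ω, hω, rfl⟩ := cs.exists_isReduced x
  exact (cs.isLeftInversion_of_mem_leftInvSeq hω (cs.mem_leftInvSeq_of_side_ne_zero ω h)).2

theorem length_lt_mul_of_side_eq_zero {t x : Γ} (ht : cs.IsReflection t) (h : cs.side t x = 0) :
    cs.length x < cs.length (t * x) := by
  have := cs.length_mul_lt_of_side_ne_zero (t := t) (x := t * x)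
    (by rw [cs.side_reflection_mul ht, h]; decide)
  rwa [← mul_assoc, ht.mul_self, one_mul] at this

theorem side_ne_zero_iff_mem_leftInvSeq {ω : List B} (hω : cs.IsReduced ω) {t : Γ} :
    cs.side t (cs.wordProd ω) ≠ 0 ↔ t ∈ cs.leftInvSeq ω := by
  refine ⟨cs.mem_leftInvSeq_of_side_ne_zero ω, fun h h0 => ?_⟩
  have h1 := cs.isLeftInversion_of_mem_leftInvSeq hω h
  exact (h1.2.trans (cs.length_lt_mul_of_side_eq_zero h1.1 h0)).false

/-- The vertices lying on the side `a` of the wall of the reflection `t`. -/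
def halfSpace (t : Γ) (a : ZMod 2) : Set Γ := {x | cs.side t x = a}

theorem mem_halfSpace {t x : Γ} {a : ZMod 2} : x ∈ cs.halfSpace t a ↔ cs.side t x = a := Iff.rfl

theorem zmod_two_ne_iff {a b : ZMod 2} : a ≠ b ↔ a = b + 1 := by
  revert a b; decide

theorem zmod_two_ne_add_one (a : ZMod 2) : a ≠ a + 1 := by
  revert a; decide

theorem zmod_two_eq (a : ZMod 2) : a = 0 ∨ a = 1 := by
  revert a; decide

theorem notMem_halfSpace {t x : Γ} {a : ZMod 2} :
    x ∉ cs.halfSpace t a ↔ x ∈ cs.halfSpace t (a + 1) := by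
  rw [mem_halfSpace, mem_halfSpace]; exact zmod_two_ne_iff

/-- Reflecting one of two vertices separated by a wall brings them closer. -/
theorem wordDist_reflection_mul_lt {t x y : Γ} (h : cs.side t x ≠ cs.side t y) :
    cs.wordDist x (t * y) < cs.wordDist x y := by
  have h1 : cs.side (x⁻¹ * t * x) (x⁻¹ * y) ≠ 0 := by
    have := cs.side_mul t x (x⁻¹ * y)
    rw [mul_inv_cancel_left] at this
    intro h0
    rw [h0, add_zero] at this
    exact h this.symm
  have := cs.length_mul_lt_of_side_ne_zero h1
  simpa [wordDist, mul_assoc] using this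

theorem negHalfSpace_eq (i : B) : cs.negHalfSpace i = cs.halfSpace (cs.simple i) 0 := by
  ext x
  constructor
  · intro h
    by_contra h0
    have h1 := cs.length_mul_lt_of_side_ne_zero h0
    rw [negHalfSpace, Set.mem_ofPred_eq] at h
    omega
  · intro h
    have h1 := cs.length_lt_mul_of_side_eq_zero (cs.isReflection_simple i) h
    rcases cs.length_simple_mul x i with h2 | h2
    · exact h2
    · omega

theorem posHalfSpace_eq (i : B) : cs.posHalfSpace i = cs.halfSpace (cs.simple i) 1 := by
  ext x
  have h1 : x ∈ cs.halfSpace (cs.simple i) 1 ↔ x ∉ cs.negHalfSpace i := by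
    rw [negHalfSpace_eq, notMem_halfSpace, zero_add]
  rw [h1, posHalfSpace, negHalfSpace, Set.mem_ofPred_eq, Set.mem_ofPred_eq]
  have := cs.length_simple_mul x i
  omega

theorem smul_halfSpace (g t : Γ) (a : ZMod 2) :
    g • cs.halfSpace t a
      = cs.halfSpace (g * t * g⁻¹) (cs.side (g * t * g⁻¹) g + a) := by
  ext x
  rw [Set.mem_smul_set_iff_inv_smul_mem, smul_eq_mul, mem_halfSpace, mem_halfSpace]
  have := cs.side_mul (g * t * g⁻¹) g (g⁻¹ * x)
  rw [mul_inv_cancel_left] at this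
  rw [this]
  simp [mul_assoc]

theorem smul_posHalfSpace (g : Γ) (i : B) :
    g • cs.posHalfSpace i = (g * cs.simple i) • cs.negHalfSpace i := by
  rw [posHalfSpace_eq, negHalfSpace_eq, mul_smul, smul_halfSpace cs (cs.simple i)]
  simp [side_simple]

theorem mem_smul_negHalfSpace (g : Γ) (i : B) : g ∈ g • cs.negHalfSpace i := by
  rw [Set.mem_smul_set_iff_inv_smul_mem, negHalfSpace_eq]
  simp [mem_halfSpace, side_one]

theorem isReflection_wallReflection (g : Γ) (i : B) : cs.IsReflection (cs.wallReflection g i) :=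
  ⟨g, i, rfl⟩

theorem smul_negHalfSpace_eq (g : Γ) (i : B) :
    g • cs.negHalfSpace i
      = cs.halfSpace (cs.wallReflection g i) (cs.side (cs.wallReflection g i) g) := by
  rw [negHalfSpace_eq, smul_halfSpace, add_zero]; rfl

theorem smul_posHalfSpace_eq (g : Γ) (i : B) :
    g • cs.posHalfSpace i
      = cs.halfSpace (cs.wallReflection g i) (cs.side (cs.wallReflection g i) g + 1) := by
  rw [posHalfSpace_eq, smul_halfSpace]; rfl

/-! ### Intervals and thin triangles -/

/-- The vertex `q` lies on a geodesic from `x` to `y`. -/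
def Between (x q y : Γ) : Prop := cs.wordDist x q + cs.wordDist q y = cs.wordDist x y

/-- A set of vertices is convex when it contains every geodesic between two of its points. -/
def IsConvexSet (E : Set Γ) : Prop := ∀ x ∈ E, ∀ y ∈ E, ∀ q, cs.Between x q y → q ∈ E

variable {cs}

theorem Between.symm {x q y : Γ} (h : cs.Between x q y) : cs.Between y q x := by
  unfold Between at *
  rw [cs.wordDist_comm y q, cs.wordDist_comm q x, cs.wordDist_comm y x]
  omega

theorem Between.dist_left_le {x q y : Γ} (h : cs.Between x q y) :
    cs.wordDist x q ≤ cs.wordDist x y := by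
  unfold Between at h; omega

theorem GeodesicRay.between (c : cs.GeodesicRay) {i j k : ℕ} (hij : i ≤ j) (hjk : j ≤ k) :
    cs.Between (c.vertex i) (c.vertex j) (c.vertex k) := by
  unfold Between
  rw [c.isGeodesic i j hij, c.isGeodesic j k hjk, c.isGeodesic i k (hij.trans hjk)]
  omega

theorem IsGeodesicLine.between {c : ℤ → Γ} (h : cs.IsGeodesicLine c) {i j k : ℤ}
    (hij : i ≤ j) (hjk : j ≤ k) : cs.Between (c i) (c j) (c k) := by
  unfold Between
  have h1 := h i j hij
  have h2 := h j k hjk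
  have h3 := h i k (hij.trans hjk)
  omega

variable (cs)

/-- Half-spaces are convex: otherwise, reflecting the middle vertex of a geodesic would shorten
it. -/
theorem isConvexSet_halfSpace (t : Γ) (a : ZMod 2) : cs.IsConvexSet (cs.halfSpace t a) := by
  intro x hx y hy q hq
  by_contra h
  rw [mem_halfSpace] at hx hy h
  have h1 := cs.wordDist_reflection_mul_lt (t := t) (x := x) (y := q) (by rw [hx]; exact Ne.symm h)
  have h2 := cs.wordDist_reflection_mul_lt (t := t) (x := y) (y := q) (by rw [hy]; exact Ne.symm h)
  have h3 := cs.wordDist_triangle x (t * q) y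
  rw [cs.wordDist_comm y, cs.wordDist_comm y] at h2
  unfold Between at hq
  omega

theorem finite_setOf_wordDist_le [Finite B] (x : Γ) (R : ℕ) : {y | cs.wordDist x y ≤ R}.Finite := by
  refine ((List.finite_length_le B R).image fun ω => x * cs.wordProd ω).subset ?_
  intro y hy
  obtain ⟨ω, hω, h⟩ := cs.exists_isReduced (x⁻¹ * y)
  refine ⟨ω, ?_, ?_⟩
  · have : ω.length = cs.wordDist x y := by rw [wordDist, h]; exact hω.symm
    exact this.trans_le hy
  · simp [← h]

theorem wordDist_mul_simple_le (x : Γ) (i : B) : cs.wordDist x (x * cs.simple i) ≤ 1 := by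
  simp [wordDist]

theorem wordDist_le_of_step {p : ℕ → Γ} {n : ℕ}
    (hp : ∀ i < n, cs.wordDist (p i) (p (i + 1)) ≤ 1) {i j : ℕ} (hij : i ≤ j) (hj : j ≤ n) :
    cs.wordDist (p i) (p j) ≤ j - i := by
  induction j, hij using Nat.le_induction with
  | base => simp [wordDist_self]
  | succ j hij ih =>
    have h1 := ih (by omega)
    have h2 := hp j (by omega)
    have h3 := cs.wordDist_triangle (p i) (p j) (p (j + 1))
    omega

theorem isGeodesicSegment_of_step {x y : Γ} {p : ℕ → Γ} (h0 : p 0 = x)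
    (h1 : p (cs.wordDist x y) = y)
    (hp : ∀ i < cs.wordDist x y, cs.wordDist (p i) (p (i + 1)) ≤ 1) :
    cs.IsGeodesicSegment x y p := by
  refine ⟨h0, h1, fun i j hij hj => ?_⟩
  have a1 := cs.wordDist_le_of_step hp (Nat.zero_le i) (hij.trans hj)
  have a2 := cs.wordDist_le_of_step hp hij hj
  have a3 := cs.wordDist_le_of_step hp hj le_rfl
  have b1 := cs.wordDist_triangle x (p i) y
  have b2 := cs.wordDist_triangle (p i) (p j) y
  rw [h0] at a1
  rw [h1] at a3
  omega

theorem exists_isGeodesicSegment (x y : Γ) : ∃ p, cs.IsGeodesicSegment x y p := by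
  obtain ⟨ω, hω, h⟩ := cs.exists_isReduced (x⁻¹ * y)
  have hl : cs.wordDist x y = ω.length := by rw [wordDist, h]; exact hω
  refine ⟨fun i => x * cs.wordProd (ω.take i), cs.isGeodesicSegment_of_step (by simp) ?_ ?_⟩
  · simp [hl, ← h]
  · intro i hi
    rw [wordDist_mul_left, List.take_add_one,
      List.getElem?_eq_getElem (by omega : i < ω.length), wordProd_append]
    simpa using cs.wordDist_mul_simple_le (cs.wordProd (ω.take i)) ω[i]

theorem IsGeodesicSegment.between {x y : Γ} {p : ℕ → Γ} (h : cs.IsGeodesicSegment x y p) {i : ℕ}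
    (hi : i ≤ cs.wordDist x y) : cs.Between x (p i) y := by
  obtain ⟨h0, h1, h2⟩ := h
  have a := h2 0 i (Nat.zero_le _) hi
  have b := h2 i _ hi le_rfl
  rw [h0] at a
  rw [h1] at b
  unfold Between
  omega

theorem exists_isGeodesicSegment_through {x q y : Γ} (h : cs.Between x q y) :
    ∃ p, cs.IsGeodesicSegment x y p ∧ p (cs.wordDist x q) = q := by
  obtain ⟨p, p0, p1, p2⟩ := cs.exists_isGeodesicSegment x q
  obtain ⟨r, r0, r1, r2⟩ := cs.exists_isGeodesicSegment q y
  unfold Between at h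
  refine ⟨fun i => if i ≤ cs.wordDist x q then p i else r (i - cs.wordDist x q),
    cs.isGeodesicSegment_of_step (by simpa using p0) ?_ ?_, by simpa using p1⟩
  · split_ifs with h1
    · have : cs.wordDist q y = 0 := by omega
      rw [this, r0] at r1
      rw [← h, this, add_zero, p1, r1]
    · rw [← h, Nat.add_sub_cancel_left, r1]
  · intro i hi
    split_ifs with h1 h2 h2
    · exact (p2 i (i + 1) (by omega) h2).le.trans (by omega)
    · have h3 : i = cs.wordDist x q := by omega
      subst h3
      rw [p1, Nat.add_sub_cancel_left]
      nth_rw 1 [← r0]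
      exact (r2 0 1 (by omega) (by omega)).le
    · omega
    · exact (r2 _ _ (by omega) (by omega)).le.trans (by omega)

/-- Thinness of triangles in terms of intervals rather than chosen geodesics, and thinness of the
bigons having a part of a geodesic ray as one side. -/
structure IsThin (δ : ℕ) : Prop where
  triangle : ∀ x y z q, cs.Between x q y →
    (∃ r, cs.Between y r z ∧ cs.wordDist q r ≤ δ) ∨ ∃ r, cs.Between z r x ∧ cs.wordDist q r ≤ δ
  bigon : ∀ (c : cs.GeodesicRay) (i j : ℕ) (q : Γ), i ≤ j → cs.Between (c.vertex i) q (c.vertex j) →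
    ∃ k, cs.wordDist q (c.vertex k) ≤ δ

theorem IsGromovHyperbolic.exists_isThin (h : cs.IsGromovHyperbolic) : ∃ δ, cs.IsThin δ := by
  obtain ⟨δ, hδ⟩ := h
  refine ⟨δ, fun x y z q hq => ?_, fun c i j q hij hq => ?_⟩
  · obtain ⟨p, hp, hpq⟩ := cs.exists_isGeodesicSegment_through hq
    obtain ⟨p', hp'⟩ := cs.exists_isGeodesicSegment y z
    obtain ⟨p'', hp''⟩ := cs.exists_isGeodesicSegment z x
    rcases hδ x y z p p' p'' hp hp' hp'' _ hq.dist_left_le with ⟨k, hk, h⟩ | ⟨k, hk, h⟩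
    · exact Or.inl ⟨p' k, IsGeodesicSegment.between cs hp' hk, hpq ▸ h⟩
    · exact Or.inr ⟨p'' k, IsGeodesicSegment.between cs hp'' hk, hpq ▸ h⟩
  · obtain ⟨p, hp, hpq⟩ := cs.exists_isGeodesicSegment_through hq
    have hl : cs.wordDist (c.vertex j) (c.vertex i) = j - i := by
      rw [wordDist_comm, c.isGeodesic i j hij]
    -- the triangle with a constant side at `c j` and the reversed initial segment of the ray
    rcases hδ _ _ (c.vertex j) p (fun _ => c.vertex j) (fun a => c.vertex (j - a)) hp
      (by simp [IsGeodesicSegment, wordDist_self]; omega)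
      ⟨by simp, by simp only [hl, Nat.sub_sub_self hij], fun a b hab hb => by
        rw [wordDist_comm, c.isGeodesic _ _ (by omega)]; omega⟩
      _ hq.dist_left_le with ⟨k, hk, h⟩ | ⟨k, hk, h⟩
    · exact ⟨j, hpq ▸ h⟩
    · exact ⟨j - k, hpq ▸ h⟩

/-- A sequence of families of points in finite balls has a pointwise limit along a nonprincipal ultrafilter. -/
theorem exists_eventually_hyperfilter_eq [Finite B] {ι : Type*} (f : ℕ → ι → Γ) (o : Γ) (R : ι → ℕ)
    (hf : ∀ n i, cs.wordDist o (f n i) ≤ R i) :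
    ∃ g : ι → Γ, ∀ i, ∀ᶠ n in (hyperfilter ℕ : Filter ℕ), f n i = g i := by
  have h : ∀ i, ∃ x, ∀ᶠ n in (hyperfilter ℕ : Filter ℕ), f n i = x := by
    intro i
    have := (Ultrafilter.eventually_exists_mem_iff (f := hyperfilter ℕ)
      (P := fun x n => f n i = x) (cs.finite_setOf_wordDist_le o (R i))).1
      (Eventually.of_forall fun n => ⟨f n i, hf n i, rfl⟩)
    obtain ⟨x, -, hx⟩ := this
    exact ⟨x, hx⟩
  choose g hg using h
  exact ⟨g, hg⟩

theorem eventually_hyperfilter_ge (k : ℕ) : ∀ᶠ n in (hyperfilter ℕ : Filter ℕ), k ≤ n :=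
  Nat.hyperfilter_le_atTop (eventually_ge_atTop k)

/-! ### Convergence to the boundary and limit sets -/

theorem exists_endpoint_eq (z : cs.Boundary) : ∃ c, cs.endpoint c = z := Quotient.exists_rep z

theorem endpoint_eq_iff {c c' : cs.GeodesicRay} : cs.endpoint c = cs.endpoint c' ↔
    ∃ K : ℕ, ∀ n, cs.wordDist (c.vertex n) (c'.vertex n) ≤ K := Quotient.eq

variable {cs}

/-- The ray obtained by forgetting the first `k` vertices. -/
def GeodesicRay.tail (c : cs.GeodesicRay) (k : ℕ) : cs.GeodesicRay :=
  ⟨fun n => c.vertex (k + n), fun i j h => by rw [c.isGeodesic _ _ (by omega)]; omega⟩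

/-- The ray of the vertices `c k, c (k + 1), …` of a bi-infinite geodesic `c`. -/
def IsGeodesicLine.forwardRay {c : ℤ → Γ} (h : cs.IsGeodesicLine c) (k : ℤ) : cs.GeodesicRay :=
  ⟨fun n => c (k + n), fun i j hij => by have := h (k + i) (k + j) (by omega); omega⟩

variable (cs)

theorem endpoint_tail (c : cs.GeodesicRay) (k : ℕ) : cs.endpoint (c.tail k) = cs.endpoint c := by
  rw [endpoint_eq_iff]
  refine ⟨k, fun n => ?_⟩
  rw [wordDist_comm]
  exact (c.isGeodesic n (k + n) (by omega)).le.trans (by omega)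

/-- Rays are asymptotic as soon as one of them stays near the other as a set. -/
theorem endpoint_eq_of_near {c c' : cs.GeodesicRay} (D : ℕ)
    (h : ∀ k, ∃ j, cs.wordDist (c.vertex k) (c'.vertex j) ≤ D) :
    cs.endpoint c = cs.endpoint c' := by
  rw [endpoint_eq_iff]
  refine ⟨2 * D + cs.wordDist (c.vertex 0) (c'.vertex 0), fun k => ?_⟩
  obtain ⟨j, hj⟩ := h k
  have h1 := c.isGeodesic 0 k (Nat.zero_le _)
  have h2 := c'.isGeodesic 0 j (Nat.zero_le _)
  have h3 : cs.wordDist (c'.vertex j) (c'.vertex k) ≤ (j - k) + (k - j) := by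
    rcases le_total j k with hjk | hjk
    · rw [c'.isGeodesic j k hjk]; omega
    · rw [wordDist_comm, c'.isGeodesic k j hjk]; omega
  have t1 := cs.wordDist_triangle (c.vertex k) (c'.vertex j) (c'.vertex k)
  have t2 := cs.wordDist_triangle (c.vertex 0) (c'.vertex 0) (c.vertex k)
  have t3 := cs.wordDist_triangle (c'.vertex 0) (c'.vertex j) (c.vertex k)
  have t4 := cs.wordDist_triangle (c'.vertex 0) (c.vertex 0) (c'.vertex j)
  have t5 := cs.wordDist_triangle (c.vertex 0) (c.vertex k) (c'.vertex j)
  have e1 := cs.wordDist_comm (c'.vertex j) (c.vertex k)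
  have e2 := cs.wordDist_comm (c'.vertex 0) (c.vertex 0)
  omega

theorem gromovProduct_le_add (x y x' y' : Γ) : cs.gromovProduct x y ≤
    cs.gromovProduct x' y' + (cs.wordDist x x' + cs.wordDist y y' : ℕ) := by
  unfold gromovProduct
  have t1 := cs.wordDist_triangle 1 x' x
  have t2 := cs.wordDist_triangle 1 y' y
  have t3 := cs.wordDist_triangle x' x y'
  have t4 := cs.wordDist_triangle x y y'
  rw [cs.wordDist_comm x' x] at t1 t3
  rw [cs.wordDist_comm y' y] at t2
  have h : ((cs.wordDist 1 x + cs.wordDist 1 y + cs.wordDist x' y' : ℕ) : ℝ) ≤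
      (cs.wordDist 1 x' + cs.wordDist 1 y' + cs.wordDist x y
        + 2 * (cs.wordDist x x' + cs.wordDist y y') : ℕ) := by
    exact_mod_cast (by omega)
  push_cast at h ⊢
  linarith

variable {cs}

theorem ConvergesTo.tendsto {x : ℕ → Γ} {z : cs.Boundary} (h : cs.ConvergesTo x z)
    {c : cs.GeodesicRay} (hc : cs.endpoint c = z) :
    Tendsto (fun k : ℕ × ℕ => cs.gromovProduct (x k.1) (c.vertex k.2)) atTop atTop := by
  obtain ⟨c', hc', h⟩ := h
  obtain ⟨K, hK⟩ := (cs.endpoint_eq_iff).1 (hc'.trans hc.symm)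
  refine tendsto_atTop_mono (fun k => ?_) (tendsto_atTop_add_const_right _ (-(K : ℝ)) h)
  have h1 := cs.gromovProduct_le_add (x k.1) (c'.vertex k.2) (x k.1) (c.vertex k.2)
  have h2 : ((cs.wordDist (x k.1) (x k.1) + cs.wordDist (c'.vertex k.2) (c.vertex k.2) : ℕ) : ℝ)
      ≤ K := by
    rw [wordDist_self, zero_add]; exact_mod_cast hK k.2
  linarith

theorem ConvergesTo.of_near {x y : ℕ → Γ} {z : cs.Boundary} (h : cs.ConvergesTo x z) (K : ℕ)
    (hK : ∀ n, cs.wordDist (x n) (y n) ≤ K) : cs.ConvergesTo y z := by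
  obtain ⟨c, hc, h⟩ := h
  refine ⟨c, hc, tendsto_atTop_mono (fun k => ?_) (tendsto_atTop_add_const_right _ (-(K : ℝ)) h)⟩
  have h1 := cs.gromovProduct_le_add (x k.1) (c.vertex k.2) (y k.1) (c.vertex k.2)
  have h2 : ((cs.wordDist (x k.1) (y k.1) + cs.wordDist (c.vertex k.2) (c.vertex k.2) : ℕ) : ℝ)
      ≤ K := by
    rw [wordDist_self, add_zero]; exact_mod_cast hK k.1
  linarith

theorem ConvergesTo.smul {x : ℕ → Γ} {z : cs.Boundary} (h : cs.ConvergesTo x z) (g : Γ) :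
    cs.ConvergesTo (fun n => g * x n) (g • z) := by
  obtain ⟨c, rfl, h⟩ := h
  refine ⟨cs.translate g c, (cs.smul_endpoint g c).symm,
    tendsto_atTop_mono (fun k => ?_) (tendsto_atTop_add_const_right _ (-(cs.wordDist 1 g : ℝ)) h)⟩
  show _ ≤ cs.gromovProduct (g * x k.1) (g * c.vertex k.2)
  unfold gromovProduct
  rw [wordDist_mul_left]
  have e : ∀ y, cs.wordDist 1 y ≤ cs.wordDist 1 g + cs.wordDist 1 (g * y) := by
    intro y
    have t1 := cs.wordDist_triangle g 1 (g * y)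
    have t2 := cs.wordDist_mul_left g 1 y
    rw [mul_one] at t2
    rw [cs.wordDist_comm g 1] at t1
    omega
  have e1 : (cs.wordDist 1 (x k.1) : ℝ) ≤ cs.wordDist 1 g + cs.wordDist 1 (g * x k.1) := by
    exact_mod_cast e _
  have e2 : (cs.wordDist 1 (c.vertex k.2) : ℝ) ≤
      cs.wordDist 1 g + cs.wordDist 1 (g * c.vertex k.2) := by exact_mod_cast e _
  linarith

variable (cs)

theorem limitSet_smul (g : Γ) (E : Set Γ) : cs.limitSet (g • E) = g • cs.limitSet E := by
  have h : ∀ (g : Γ) (E : Set Γ), g • cs.limitSet E ⊆ cs.limitSet (g • E) := by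
    rintro g E _ ⟨z, ⟨x, hx, hz⟩, rfl⟩
    exact ⟨fun n => g * x n, fun n => Set.smul_mem_smul_set (hx n), hz.smul g⟩
  refine Set.Subset.antisymm ?_ (h g E)
  rw [Set.subset_smul_set_iff]
  simpa using h g⁻¹ (g • E)

theorem limitSet_mono {E E' : Set Γ} (h : E ⊆ E') : cs.limitSet E ⊆ cs.limitSet E' :=
  fun _ ⟨x, hx, hz⟩ => ⟨x, fun n => h (hx n), hz⟩

theorem limitSet_empty : cs.limitSet ∅ = ∅ :=
  Set.eq_empty_of_forall_notMem fun _ ⟨_, hx, _⟩ => hx 0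

/-- Sets at bounded distance have the same limit set. -/
theorem limitSet_subset_of_near {E E' : Set Γ} (K : ℕ)
    (h : ∀ x ∈ E, ∃ y ∈ E', cs.wordDist x y ≤ K) : cs.limitSet E ⊆ cs.limitSet E' := by
  rintro z ⟨x, hx, hz⟩
  choose y hy hxy using fun n => h (x n) (hx n)
  exact ⟨y, hy, hz.of_near K hxy⟩

theorem convergesTo_vertex (c : cs.GeodesicRay) : cs.ConvergesTo c.vertex (cs.endpoint c) := by
  refine ⟨c, rfl, tendsto_atTop.2 fun b => ?_⟩
  obtain ⟨N, hN⟩ := exists_nat_ge (b + cs.wordDist 1 (c.vertex 0))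
  filter_upwards [eventually_ge_atTop (N, N)] with ⟨k, m⟩ ⟨hk, hm⟩
  simp only at hk hm ⊢
  unfold gromovProduct
  have h : cs.wordDist (c.vertex k) (c.vertex m) + 2 * N ≤
      cs.wordDist 1 (c.vertex k) + cs.wordDist 1 (c.vertex m)
        + 2 * cs.wordDist 1 (c.vertex 0) := by
    have t1 := cs.wordDist_triangle (c.vertex 0) 1 (c.vertex k)
    have t2 := cs.wordDist_triangle (c.vertex 0) 1 (c.vertex m)
    rw [cs.wordDist_comm _ 1, c.isGeodesic 0 _ (Nat.zero_le _)] at t1 t2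
    rcases le_total k m with hkm | hkm
    · rw [c.isGeodesic k m hkm]; omega
    · rw [cs.wordDist_comm (c.vertex k), c.isGeodesic m k hkm]; omega
  have h' : (cs.wordDist (c.vertex k) (c.vertex m) + 2 * N : ℝ) ≤
      cs.wordDist 1 (c.vertex k) + cs.wordDist 1 (c.vertex m)
        + 2 * cs.wordDist 1 (c.vertex 0) := by exact_mod_cast h
  linarith

theorem endpoint_mem_limitSet_of_near {c : cs.GeodesicRay} {E : Set Γ} (K : ℕ)
    (h : ∀ k, ∃ y ∈ E, cs.wordDist (c.vertex k) y ≤ K) : cs.endpoint c ∈ cs.limitSet E := by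
  choose y hy hxy using h
  exact ⟨y, hy, (cs.convergesTo_vertex c).of_near K hxy⟩

theorem endpoint_mem_limitSet_of_eventually {c : cs.GeodesicRay} {E : Set Γ} (k : ℕ)
    (h : ∀ n, k ≤ n → c.vertex n ∈ E) : cs.endpoint c ∈ cs.limitSet E := by
  rw [← endpoint_tail cs c k]
  exact cs.endpoint_mem_limitSet_of_near 0 fun n => ⟨_, h (k + n) (by omega),
    (cs.wordDist_self _).le⟩

/-- Near a limit point of `E` there are points `x` of `E` whose geodesics to the far vertices of a
ray to the limit point avoid a given ball. -/
theorem exists_mem_forall_between_lt {E : Set Γ} {c : cs.GeodesicRay}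
    (h : cs.endpoint c ∈ cs.limitSet E) (o : Γ) (R : ℕ) :
    ∃ x ∈ E, ∃ N : ℕ, ∀ m ≥ N, ∀ r, cs.Between x r (c.vertex m) → R < cs.wordDist o r := by
  obtain ⟨x, hx, hz⟩ := h
  have h1 := (hz.tendsto rfl).eventually (eventually_gt_atTop ((R + cs.wordDist 1 o : ℕ) : ℝ))
  obtain ⟨⟨a, b⟩, hab⟩ := eventually_atTop.1 h1
  refine ⟨x a, hx a, b, fun m hm r hr => ?_⟩
  have h2 := hab (a, m) ⟨le_rfl, hm⟩
  simp only [gromovProduct] at h2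
  rw [lt_div_iff₀ two_pos, lt_sub_iff_add_lt] at h2
  have h3 : (R + cs.wordDist 1 o) * 2 + cs.wordDist (x a) (c.vertex m) <
      cs.wordDist 1 (x a) + cs.wordDist 1 (c.vertex m) := by exact_mod_cast h2
  have t1 := cs.wordDist_triangle 1 r (x a)
  have t2 := cs.wordDist_triangle 1 r (c.vertex m)
  have t3 := cs.wordDist_triangle 1 o r
  rw [cs.wordDist_comm r (x a)] at t1
  unfold Between at hr
  omega

/-! ### Thin triangles at infinity -/

section Thin

variable {cs} {δ : ℕ}

/-- A ray to a limit point of a convex set stays near this set. -/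
theorem IsThin.exists_near_of_mem_limitSet (hδ : cs.IsThin δ) {E : Set Γ} (hE : cs.IsConvexSet E)
    {c : cs.GeodesicRay} (hc : cs.endpoint c ∈ cs.limitSet E) {e : Γ} (he : e ∈ E) (k : ℕ) :
    ∃ y ∈ E, cs.wordDist (c.vertex k) y ≤ 2 * δ + cs.wordDist (c.vertex 0) e := by
  obtain ⟨x, hx, N, hN⟩ := cs.exists_mem_forall_between_lt hc (c.vertex 0) (k + δ)
  have hk := c.isGeodesic 0 k (Nat.zero_le _)
  rcases hδ.triangle _ _ x _ (c.between (Nat.zero_le k) (le_max_left k N)) with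
    ⟨r, hr, hd⟩ | ⟨r, hr, hd⟩
  · have := hN _ (le_max_right k N) r hr.symm
    have t := cs.wordDist_triangle (c.vertex 0) (c.vertex k) r
    omega
  · rcases hδ.triangle _ _ e _ hr with ⟨r', hr', hd'⟩ | ⟨r', hr', hd'⟩
    · refine ⟨e, he, ?_⟩
      have t1 := cs.wordDist_triangle (c.vertex k) r e
      have t2 := cs.wordDist_triangle r r' e
      unfold Between at hr'
      omega
    · refine ⟨r', hE _ he _ hx _ hr', ?_⟩
      have t1 := cs.wordDist_triangle (c.vertex k) r r'
      omega

/-- A bi-infinite geodesic between two limit points of a convex set stays near this set. -/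
theorem IsThin.exists_near_of_joins (hδ : cs.IsThin δ) {E : Set Γ} (hE : cs.IsConvexSet E)
    {z w : cs.Boundary} (hz : z ∈ cs.limitSet E) (hw : w ∈ cs.limitSet E) {L : ℤ → Γ}
    (hL : cs.Joins L z w) (k : ℤ) : ∃ y ∈ E, cs.wordDist (L k) y ≤ 2 * δ := by
  obtain ⟨hL, ⟨ρ, hρ, rfl⟩, ρ', hρ', rfl⟩ := hL
  obtain ⟨x, hx, N, hN⟩ := cs.exists_mem_forall_between_lt hz (L k) (2 * δ)
  obtain ⟨x', hx', N', hN'⟩ := cs.exists_mem_forall_between_lt hw (L k) (2 * δ)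
  set m := max (max N N') k.natAbs with hm
  have hbt : cs.Between (L (-(m : ℤ))) (L k) (L m) := hL.between (by omega) (by omega)
  rcases hδ.triangle _ _ x _ hbt with ⟨r, hr, hd⟩ | ⟨r, hr, hd⟩
  · rcases hδ.triangle _ _ x' _ hr with ⟨r', hr', hd'⟩ | ⟨r', hr', hd'⟩
    · refine ⟨r', hE _ hx _ hx' _ hr', ?_⟩
      have t1 := cs.wordDist_triangle (L k) r r'
      omega
    · have := hN' m (by omega) r' (by rw [hρ']; exact hr')
      have t1 := cs.wordDist_triangle (L k) r r'
      omega
  · have := hN m (by omega) r (by rw [hρ]; exact hr)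
    omega

/-- Limit points of a convex set far from `o` are near each other, as seen from `o`. -/
theorem IsThin.exists_near_of_far (hδ : cs.IsThin δ) {E : Set Γ} (hE : cs.IsConvexSet E)
    {c c' : cs.GeodesicRay} (h0 : c.vertex 0 = c'.vertex 0)
    (hz : cs.endpoint c ∈ cs.limitSet E) (hw : cs.endpoint c' ∈ cs.limitSet E) {k : ℕ}
    (hk : ∀ y ∈ E, k + 2 * δ < cs.wordDist (c.vertex 0) y) :
    ∃ j, cs.wordDist (c.vertex k) (c'.vertex j) ≤ 4 * δ := by
  obtain ⟨x, hx, N, hN⟩ := cs.exists_mem_forall_between_lt hz (c.vertex 0) (k + 3 * δ)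
  obtain ⟨x', hx', N', hN'⟩ := cs.exists_mem_forall_between_lt hw (c.vertex 0) (k + 3 * δ)
  have hd0 := c.isGeodesic 0 k (Nat.zero_le _)
  rcases hδ.triangle _ _ x _ (c.between (Nat.zero_le k) (le_max_left k N)) with
    ⟨r, hr, hd⟩ | ⟨r, hr, hd⟩
  · have := hN _ (le_max_right k N) r hr.symm
    have t := cs.wordDist_triangle (c.vertex 0) (c.vertex k) r
    omega
  have t := cs.wordDist_triangle (c.vertex 0) (c.vertex k) r
  rcases hδ.triangle _ _ x' _ hr with ⟨r', hr', hd'⟩ | ⟨r', hr', hd'⟩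
  · rcases hδ.triangle _ _ (c'.vertex N') _ hr' with ⟨r₂, hr₂, hd₂⟩ | ⟨r₂, hr₂, hd₂⟩
    · have := hN' _ le_rfl r₂ hr₂
      have t1 := cs.wordDist_triangle (c.vertex 0) r r'
      have t2 := cs.wordDist_triangle (c.vertex 0) r' r₂
      omega
    · obtain ⟨j, hj⟩ := hδ.bigon c' 0 N' r₂ (Nat.zero_le _) (h0 ▸ hr₂.symm)
      refine ⟨j, ?_⟩
      have t1 := cs.wordDist_triangle (c.vertex k) r (c'.vertex j)
      have t2 := cs.wordDist_triangle r r' (c'.vertex j)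
      have t3 := cs.wordDist_triangle r' r₂ (c'.vertex j)
      omega
  · have := hk _ (hE _ hx' _ hx _ hr')
    have t1 := cs.wordDist_triangle (c.vertex 0) r r'
    omega

/-- Every boundary point is the endpoint of a ray from any given vertex. -/
theorem IsThin.exists_ray_from [Finite B] (hδ : cs.IsThin δ) (o : Γ) (z : cs.Boundary) :
    ∃ c : cs.GeodesicRay, c.vertex 0 = o ∧ cs.endpoint c = z := by
  obtain ⟨c, rfl⟩ := cs.exists_endpoint_eq z
  choose p hp using fun n => cs.exists_isGeodesicSegment o (c.vertex n)
  obtain ⟨g, hg⟩ := cs.exists_eventually_hyperfilter_eq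
    (fun n i => if i ≤ cs.wordDist o (c.vertex n) then p n i else o) o id (by
      intro n i
      simp only [id]
      split_ifs with h
      · have := (hp n).2.2 0 i (Nat.zero_le _) h
        rw [(hp n).1] at this
        omega
      · simp [wordDist_self])
  have hlong : ∀ k, ∀ᶠ n in (hyperfilter ℕ : Filter ℕ), k ≤ cs.wordDist o (c.vertex n) := by
    intro k
    filter_upwards [eventually_hyperfilter_ge (k + cs.wordDist (c.vertex 0) o)] with n hn
    have t := cs.wordDist_triangle (c.vertex 0) o (c.vertex n)
    rw [c.isGeodesic 0 n (Nat.zero_le _)] at t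
    omega
  have hg' : ∀ k, ∀ᶠ n in (hyperfilter ℕ : Filter ℕ), p n k = g k := by
    intro k
    filter_upwards [hg k, hlong k] with n h1 h2
    rwa [if_pos h2] at h1
  refine ⟨⟨g, fun i j hij => ?_⟩, ?_, ?_⟩
  · obtain ⟨n, h1, h2, h3⟩ := ((hg' i).and ((hg' j).and (hlong j))).exists
    rw [← h1, ← h2, (hp n).2.2 i j hij h3]
  · obtain ⟨n, h1⟩ := (hg' 0).exists
    exact h1.symm.trans (hp n).1
  · refine cs.endpoint_eq_of_near (2 * δ + cs.wordDist o (c.vertex 0)) fun k => ?_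
    obtain ⟨n, h1, h2⟩ := ((hg' k).and (hlong k)).exists
    show ∃ j, cs.wordDist (g k) _ ≤ _
    rw [← h1]
    rcases hδ.triangle _ _ (c.vertex 0) _ (IsGeodesicSegment.between cs (hp n) h2) with
      ⟨r, hr, hd⟩ | ⟨r, hr, hd⟩
    · obtain ⟨j, hj⟩ := hδ.bigon c 0 n r (Nat.zero_le _) hr.symm
      refine ⟨j, ?_⟩
      have t1 := cs.wordDist_triangle (p n k) r (c.vertex j)
      omega
    · refine ⟨0, ?_⟩
      have t1 := cs.wordDist_triangle (p n k) r (c.vertex 0)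
      have t2 := hr.dist_left_le
      rw [cs.wordDist_comm r] at t1
      rw [cs.wordDist_comm _ o] at t2
      omega

end Thin

/-! ### Bi-infinite geodesics -/

section Lines

variable {cs} {δ : ℕ}

theorem IsGeodesicSegment.between_of_le {x y : Γ} {p : ℕ → Γ} (h : cs.IsGeodesicSegment x y p)
    {i j k : ℕ} (hij : i ≤ j) (hjk : j ≤ k) (hk : k ≤ cs.wordDist x y) :
    cs.Between (p i) (p j) (p k) := by
  unfold Between
  rw [h.2.2 i j hij (hjk.trans hk), h.2.2 j k hjk hk, h.2.2 i k (hij.trans hjk) hk]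
  omega

/-- Distinct boundary points are joined by a bi-infinite geodesic: the geodesics joining far points
of two non-asymptotic rays from `1` all pass through a fixed ball. -/
theorem IsThin.exists_joins [Finite B] (hδ : cs.IsThin δ) {z w : cs.Boundary} (hzw : z ≠ w) :
    ∃ L, cs.Joins L z w := by
  obtain ⟨c, c0, hc⟩ := hδ.exists_ray_from 1 z
  obtain ⟨c', c0', hc'⟩ := hδ.exists_ray_from 1 w
  obtain ⟨k₀, hk₀⟩ : ∃ k, ∀ j, 2 * δ < cs.wordDist (c.vertex k) (c'.vertex j) := by
    by_contra! h
    exact hzw (hc.symm.trans ((cs.endpoint_eq_of_near _ h).trans hc'))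
  have hr : ∀ n, ∃ r, cs.Between (c.vertex (n + k₀)) r (c'.vertex (n + k₀)) ∧
      cs.wordDist (c.vertex k₀) r ≤ δ := by
    intro n
    rcases hδ.triangle _ _ (c'.vertex (n + k₀)) _
      (c.between (Nat.zero_le k₀) (Nat.le_add_left k₀ n)) with h | ⟨r, hr, hd⟩
    · exact h
    · exfalso
      obtain ⟨j, hj⟩ := hδ.bigon c' 0 (n + k₀) r (Nat.zero_le _) (by
        rw [c0', ← c0]; exact hr.symm)
      have t := cs.wordDist_triangle (c.vertex k₀) r (c'.vertex j)
      have := hk₀ j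
      omega
  choose r hr hrd using hr
  choose p hp hpr using fun n => cs.exists_isGeodesicSegment_through (hr n)
  obtain ⟨ℓ, hℓ⟩ : ∃ ℓ : ℕ → ℕ, ∀ n, cs.wordDist (c.vertex (n + k₀)) (r n) = ℓ n :=
    ⟨_, fun _ => rfl⟩
  obtain ⟨T, hT⟩ : ∃ T : ℕ → ℕ, ∀ n, cs.wordDist (c.vertex (n + k₀)) (c'.vertex (n + k₀)) = T n :=
    ⟨_, fun _ => rfl⟩
  have hℓT : ∀ n, ℓ n + cs.wordDist (r n) (c'.vertex (n + k₀)) = T n := fun n => by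
    rw [← hℓ, ← hT]; exact hr n
  have hpd : ∀ n i j, i ≤ j → j ≤ T n → cs.wordDist (p n i) (p n j) = j - i := fun n i j hij hj =>
    (hp n).2.2 i j hij (by rw [hT]; exact hj)
  have hpT : ∀ n, p n (T n) = c'.vertex (n + k₀) := fun n => by rw [← hT]; exact (hp n).2.1
  replace hpr : ∀ n, p n (ℓ n) = r n := fun n => by rw [← hℓ]; exact hpr n
  have hr1 : ∀ n, cs.wordDist 1 (r n) ≤ k₀ + δ := by
    intro n
    have t := cs.wordDist_triangle 1 (c.vertex k₀) (r n)
    have h1 := c.isGeodesic 0 k₀ (Nat.zero_le _)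
    rw [c0] at h1
    have := hrd n
    omega
  have hℓ1 : ∀ n, n ≤ ℓ n + δ := by
    intro n
    have t := cs.wordDist_triangle 1 (r n) (c.vertex (n + k₀))
    have h1 := c.isGeodesic 0 (n + k₀) (Nat.zero_le _)
    rw [c0] at h1
    rw [cs.wordDist_comm (r n), hℓ] at t
    have := hr1 n
    omega
  have hℓ2 : ∀ n, ℓ n + n ≤ T n + δ := by
    intro n
    have t := cs.wordDist_triangle 1 (r n) (c'.vertex (n + k₀))
    have h1 := c'.isGeodesic 0 (n + k₀) (Nat.zero_le _)
    rw [c0'] at h1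
    have := hr1 n
    have := hℓT n
    omega
  -- the geodesics, parametrized so that they are at `r n` at time `0`
  obtain ⟨L, hL⟩ := cs.exists_eventually_hyperfilter_eq (ι := ℤ)
    (fun n i => if 0 ≤ ℓ n + i ∧ ℓ n + i ≤ T n then p n (ℓ n + i).toNat else 1) 1
    (fun i => k₀ + δ + i.natAbs) (by
      intro n i
      split_ifs with h
      · have t := cs.wordDist_triangle 1 (r n) (p n (ℓ n + i).toNat)
        have h1 := hr1 n
        have hT0 := hℓT n
        have h2 : cs.wordDist (r n) (p n (ℓ n + i).toNat) ≤ i.natAbs := by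
          rw [← hpr n]
          rcases le_total 0 i with hi | hi
          · rw [hpd n _ _ (by omega) (by omega)]; omega
          · rw [wordDist_comm, hpd n _ _ (by omega) (by omega)]; omega
        omega
      · simp [wordDist_self])
  have hev : ∀ i : ℤ, ∀ᶠ n in (hyperfilter ℕ : Filter ℕ), 0 ≤ ℓ n + i ∧ ℓ n + i ≤ T n := by
    intro i
    filter_upwards [eventually_hyperfilter_ge (i.natAbs + δ)] with n hn
    have h1 := hℓ1 n
    have h2 := hℓ2 n
    omega
  have hL' : ∀ i : ℤ, ∀ᶠ n in (hyperfilter ℕ : Filter ℕ), p n (ℓ n + i).toNat = L i := by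
    intro i
    filter_upwards [hL i, hev i] with n h1 h2
    rwa [if_pos h2] at h1
  have hgeo : cs.IsGeodesicLine L := by
    intro i j hij
    obtain ⟨n, ⟨h1, h2⟩, h3, h4⟩ :=
      (((hL' i).and (hL' j)).and ((hev i).and (hev j))).exists
    rw [← h1, ← h2, hpd n _ _ (by omega) (by omega)]
    omega
  refine ⟨L, hgeo, ⟨⟨fun n => L (-n), fun i j hij => ?_⟩, fun n => rfl, ?_⟩,
    hgeo.forwardRay 0, fun n => by simp [IsGeodesicLine.forwardRay], ?_⟩
  · have := hgeo (-j) (-i) (by omega)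
    rw [wordDist_comm]
    omega
  · rw [← hc]
    refine cs.endpoint_eq_of_near (2 * δ) fun k => ?_
    obtain ⟨n, h1, h2⟩ := ((hL' (-k)).and (hev (-k))).exists
    simp only
    rw [← h1]
    have hT0 := hℓT n
    have hb := (hp n).between_of_le (Nat.zero_le (ℓ n + -(k : ℤ)).toNat)
      (by omega : _ ≤ ℓ n) (by rw [hT]; omega)
    rw [(hp n).1, hpr n] at hb
    rcases hδ.triangle _ _ (c.vertex k₀) _ hb.symm with ⟨q, hq, hd⟩ | ⟨q, hq, hd⟩
    · obtain ⟨j, hj⟩ := hδ.bigon c k₀ (n + k₀) q (by omega) hq.symm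
      refine ⟨j, ?_⟩
      have t := cs.wordDist_triangle (p n (ℓ n + -(k : ℤ)).toNat) q (c.vertex j)
      omega
    · refine ⟨k₀, ?_⟩
      have t := cs.wordDist_triangle (p n (ℓ n + -(k : ℤ)).toNat) q (c.vertex k₀)
      have := hq.dist_left_le
      have := hrd n
      rw [cs.wordDist_comm q] at t
      omega
  · rw [← hc']
    refine cs.endpoint_eq_of_near (2 * δ + k₀) fun k => ?_
    obtain ⟨n, h1, h2⟩ := ((hL' k).and (hev k)).exists
    simp only [IsGeodesicLine.forwardRay, zero_add]
    rw [← h1]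
    have hT0 := hℓT n
    have hb := (hp n).between_of_le (by omega : ℓ n ≤ (ℓ n + (k : ℤ)).toNat)
      (by omega : _ ≤ T n) (hT n).ge
    rw [hpT, hpr n] at hb
    rcases hδ.triangle _ _ 1 _ hb with ⟨q, hq, hd⟩ | ⟨q, hq, hd⟩
    · obtain ⟨j, hj⟩ := hδ.bigon c' 0 (n + k₀) q (Nat.zero_le _) (by rw [c0']; exact hq.symm)
      refine ⟨j, ?_⟩
      have t := cs.wordDist_triangle (p n (ℓ n + (k : ℤ)).toNat) q (c'.vertex j)
      omega
    · refine ⟨0, ?_⟩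
      rw [c0']
      have t := cs.wordDist_triangle (p n (ℓ n + (k : ℤ)).toNat) q 1
      have := hq.dist_left_le
      have := hr1 n
      rw [cs.wordDist_comm q] at t
      omega

/-- A bi-infinite geodesic meeting a half-space has an end in it, since it cannot leave the convex
complement twice. -/
theorem Joins.mem_limitSet_halfSpace {L : ℤ → Γ} {z w : cs.Boundary} (h : cs.Joins L z w) {t : Γ}
    {a : ZMod 2} {k : ℤ} (hk : L k ∈ cs.halfSpace t a) :
    z ∈ cs.limitSet (cs.halfSpace t a) ∨ w ∈ cs.limitSet (cs.halfSpace t a) := by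
  obtain ⟨hL, ⟨ρ, hρ, rfl⟩, ρ', hρ', rfl⟩ := h
  by_cases h1 : ∀ n, k ≤ n → L n ∈ cs.halfSpace t a
  · right
    refine cs.endpoint_mem_limitSet_of_eventually k.toNat fun n hn => ?_
    rw [hρ']
    exact h1 n (by omega)
  · push Not at h1
    obtain ⟨n₁, hn₁, h1⟩ := h1
    left
    refine cs.endpoint_mem_limitSet_of_eventually (-k).toNat fun n hn => ?_
    rw [hρ]
    by_contra h2
    rw [notMem_halfSpace] at h1 h2
    have := cs.isConvexSet_halfSpace t (a + 1) _ h2 _ h1 _ (hL.between (by omega) hn₁)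
    rw [← notMem_halfSpace] at this
    exact this hk

theorem Joins.smul {L : ℤ → Γ} {z w : cs.Boundary} (h : cs.Joins L z w) (g : Γ) :
    cs.Joins (fun n => g * L n) (g • z) (g • w) := by
  obtain ⟨hL, ⟨ρ, hρ, rfl⟩, ρ', hρ', rfl⟩ := h
  refine ⟨fun i j hij => ?_, ⟨cs.translate g ρ, fun n => ?_, rfl⟩, cs.translate g ρ', fun n => ?_,
    rfl⟩
  · rw [wordDist_mul_left]; exact hL i j hij
  · simp only [translate, hρ]
  · simp only [translate, hρ']

end Lines

/-! ### Limit sets of half-spaces -/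

section HalfSpaces

theorem finite_setOf_side_ne_zero (x : Γ) : {t | cs.side t x ≠ 0}.Finite := by
  obtain ⟨ω, hω, rfl⟩ := cs.exists_isReduced x
  exact (List.finite_toSet (cs.leftInvSeq ω)).subset fun t ht =>
    cs.mem_leftInvSeq_of_side_ne_zero ω ht

theorem limitSet_halfSpace_union (t : Γ) (a : ZMod 2) :
    cs.limitSet (cs.halfSpace t a) ∪ cs.limitSet (cs.halfSpace t (a + 1)) = Set.univ := by
  refine Set.eq_univ_of_forall fun z => ?_
  obtain ⟨c, rfl⟩ := cs.exists_endpoint_eq z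
  by_cases h : ∃ k, ∀ n, k ≤ n → c.vertex n ∈ cs.halfSpace t a
  · obtain ⟨k, hk⟩ := h
    exact Or.inl (cs.endpoint_mem_limitSet_of_eventually k hk)
  · push Not at h
    simp only [notMem_halfSpace] at h
    obtain ⟨n₀, -, h0⟩ := h 0
    refine Or.inr (cs.endpoint_mem_limitSet_of_eventually n₀ fun n hn => ?_)
    obtain ⟨m, hm, h1⟩ := h n
    exact cs.isConvexSet_halfSpace t _ _ h0 _ h1 _ (c.between hn hm)

theorem mem_limitSet_halfSpace_of_notMem {t : Γ} {a : ZMod 2} {z : cs.Boundary}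
    (h : z ∉ cs.limitSet (cs.halfSpace t a)) : z ∈ cs.limitSet (cs.halfSpace t (a + 1)) :=
  ((cs.limitSet_halfSpace_union t a).symm ▸ Set.mem_univ z :
    z ∈ cs.limitSet (cs.halfSpace t a) ∪ cs.limitSet (cs.halfSpace t (a + 1))).resolve_left h

variable {cs} {δ : ℕ}

/-- Every boundary point lies strictly inside half-spaces arbitrarily far from the identity. Indeed,
a long initial segment of a ray to this point crosses more walls than there are walls near its ends;
take a crossed wall which is far from both. -/
theorem IsThin.exists_halfSpace_far [Finite B] (hδ : cs.IsThin δ) (z : cs.Boundary) (R : ℕ) :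
    ∃ t, cs.IsReflection t ∧ (∀ y ∈ cs.halfSpace t 1, R < cs.wordDist 1 y) ∧
      z ∉ cs.limitSet (cs.halfSpace t 0) := by
  obtain ⟨c, c0, rfl⟩ := hδ.exists_ray_from 1 z
  set R' := max R (2 * δ) with hR'
  -- the reflections along the walls near the identity
  set A : Set Γ := ⋃ y ∈ {y | cs.wordDist 1 y ≤ R'}, {t | cs.side t y ≠ 0} with hA
  have hAfin : A.Finite :=
    (cs.finite_setOf_wordDist_le 1 R').biUnion fun y _ => cs.finite_setOf_side_ne_zero y
  set x := c.vertex (2 * A.ncard + 1) with hx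
  have hA'fin : ((fun t => x * t * x⁻¹) '' A).Finite := hAfin.image _
  obtain ⟨ω, hω, hxω⟩ := cs.exists_isReduced x
  obtain ⟨t, ht, ht'⟩ : ∃ t ∈ cs.leftInvSeq ω, t ∉ A ∪ (fun t => x * t * x⁻¹) '' A := by
    by_contra! h
    classical
    have h1 := Set.ncard_le_ncard (s := ((cs.leftInvSeq ω).toFinset : Set Γ))
      (fun t ht => h t (by simpa using ht)) (hAfin.union hA'fin)
    rw [Set.ncard_coe_finset, List.toFinset_card_of_nodup (hω.nodup_leftInvSeq),
      length_leftInvSeq] at h1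
    have h2 := Set.ncard_union_le A ((fun t => x * t * x⁻¹) '' A)
    have h3 := Set.ncard_image_le (f := fun t => x * t * x⁻¹) hAfin
    have h4 : ω.length = 2 * A.ncard + 1 := by
      have := c.isGeodesic 0 (2 * A.ncard + 1) (Nat.zero_le _)
      rw [c0, ← hx, wordDist, inv_one, one_mul, hxω] at this
      rw [← hω.eq, this, Nat.sub_zero]
    omega
  have htx : cs.side t x ≠ 0 := by
    rw [hxω]; exact (cs.side_ne_zero_iff_mem_leftInvSeq hω).2 ht
  refine ⟨t, cs.isReflection_of_mem_leftInvSeq ω ht, fun y hy => ?_, fun hz => ?_⟩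
  · by_contra h
    refine ht' (Or.inl (Set.mem_biUnion (x := y) ?_ ?_))
    · exact (not_lt.1 h).trans (le_max_left _ _)
    · rw [mem_halfSpace] at hy
      show cs.side t y ≠ 0
      rw [hy]; decide
  · obtain ⟨y, hy, hd⟩ := hδ.exists_near_of_mem_limitSet (cs.isConvexSet_halfSpace t 0) hz
      (e := 1) (cs.side_one t) (2 * A.ncard + 1)
    rw [c0, wordDist_self, add_zero, ← hx] at hd
    refine ht' (Or.inr ⟨x⁻¹ * t * x, Set.mem_biUnion (x := x⁻¹ * y) ?_ ?_, by simp [mul_assoc]⟩)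
    · show cs.wordDist 1 (x⁻¹ * y) ≤ R'
      have := cs.wordDist_mul_left x 1 (x⁻¹ * y)
      rw [mul_one, mul_inv_cancel_left] at this
      omega
    · show cs.side _ _ ≠ 0
      intro h0
      have := cs.side_mul t x (x⁻¹ * y)
      rw [mul_inv_cancel_left, h0, add_zero] at this
      rw [mem_halfSpace] at hy
      exact htx (this.symm.trans hy)

/-- A reflection fixes the limit points common to both sides of its wall: a ray to such a point stays
near the wall. -/
theorem IsThin.smul_eq_of_mem_limitSet (hδ : cs.IsThin δ) {t : Γ} (ht : cs.IsReflection t)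
    {z : cs.Boundary} (h : ∀ a, z ∈ cs.limitSet (cs.halfSpace t a)) : t • z = z := by
  obtain ⟨c, rfl⟩ := cs.exists_endpoint_eq z
  obtain ⟨D, hD⟩ : ∃ D, ∀ a k, ∃ y ∈ cs.halfSpace t a, cs.wordDist (c.vertex k) y ≤ D := by
    have h1 : ∀ a, ∃ e, e ∈ cs.halfSpace t a := by
      intro a
      by_cases ha : a = 0
      · exact ⟨1, by rw [mem_halfSpace, side_one, ha]⟩
      · refine ⟨t * 1, ?_⟩
        rw [mem_halfSpace, cs.side_reflection_mul ht, side_one, zero_add]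
        revert a; decide
    choose e he using h1
    refine ⟨2 * δ + (cs.wordDist (c.vertex 0) (e 0) + cs.wordDist (c.vertex 0) (e 1)),
      fun a k => ?_⟩
    obtain ⟨y, hy, hd⟩ := hδ.exists_near_of_mem_limitSet (cs.isConvexSet_halfSpace t a) (h a)
      (he a) k
    refine ⟨y, hy, hd.trans ?_⟩
    rcases zmod_two_eq a with rfl | rfl <;> omega
  rw [smul_endpoint, endpoint_eq_iff]
  refine ⟨2 * D, fun k => ?_⟩
  obtain ⟨y, hy, hd⟩ := hD (cs.side t (c.vertex k) + 1) k
  show cs.wordDist (t * c.vertex k) (c.vertex k) ≤ 2 * D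
  have h1 := cs.wordDist_reflection_mul_lt (t := t) (x := c.vertex k) (y := y) (by
    rw [mem_halfSpace] at hy; rw [hy]; exact zmod_two_ne_add_one _)
  have h2 := cs.wordDist_mul_left t (c.vertex k) (t * y)
  rw [← mul_assoc, ht.mul_self, one_mul] at h2
  have h3 := cs.wordDist_triangle (t * c.vertex k) y (c.vertex k)
  rw [cs.wordDist_comm y] at h3
  omega

end HalfSpaces

/-! ### The topology of the boundary -/

theorem isOpen_setOf_vertex_eq (k : ℕ) (x : Γ) : IsOpen {c : cs.GeodesicRay | c.vertex k = x} := by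
  let _ : TopologicalSpace Γ := ⊥
  have : DiscreteTopology Γ := ⟨rfl⟩
  have h1 : Continuous fun c : cs.GeodesicRay => c.vertex k :=
    (continuous_apply k).comp continuous_induced_dom
  exact (isOpen_discrete {x}).preimage h1

theorem isOpen_setOf_vertex (Q : Γ → Γ → Prop) (i j : ℕ) :
    IsOpen {c : cs.GeodesicRay | Q (c.vertex i) (c.vertex j)} := by
  have : {c : cs.GeodesicRay | Q (c.vertex i) (c.vertex j)} = ⋃ x, ⋃ y, ⋃ _ : Q x y,
      ({c : cs.GeodesicRay | c.vertex i = x} ∩ {c | c.vertex j = y}) := by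
    ext c
    simp
  rw [this]
  exact isOpen_iUnion fun x => isOpen_iUnion fun y => isOpen_iUnion fun _ =>
    (cs.isOpen_setOf_vertex_eq i x).inter (cs.isOpen_setOf_vertex_eq j y)

theorem isQuotientMap_endpoint : IsQuotientMap cs.endpoint := isQuotientMap_quotient_mk'

theorem continuous_boundary_smul (g : Γ) : Continuous fun z : cs.Boundary => g • z := by
  rw [cs.isQuotientMap_endpoint.continuous_iff]
  refine cs.isQuotientMap_endpoint.continuous.comp (f := cs.translate g) ?_
  let _ : TopologicalSpace Γ := ⊥
  have : DiscreteTopology Γ := ⟨rfl⟩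
  refine continuous_induced_rng.2 (continuous_pi fun n => ?_)
  exact (continuous_of_discreteTopology (f := fun x => g * x)).comp
    ((continuous_apply n).comp continuous_induced_dom)

section Topology

variable {cs} {δ : ℕ}

theorem IsThin.isClosed_limitSet (hδ : cs.IsThin δ) {E : Set Γ} (hE : cs.IsConvexSet E) :
    IsClosed (cs.limitSet E) := by
  rcases E.eq_empty_or_nonempty with rfl | ⟨e, he⟩
  · rw [limitSet_empty]; exact isClosed_empty
  rw [← cs.isQuotientMap_endpoint.isClosed_preimage]
  have : cs.endpoint ⁻¹' cs.limitSet E = ⋂ k, {c : cs.GeodesicRay | ∃ y ∈ E,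
      cs.wordDist (c.vertex k) y ≤ 2 * δ + cs.wordDist (c.vertex 0) e} := by
    ext c
    simp only [Set.mem_preimage, Set.mem_iInter]
    exact ⟨fun h k => hδ.exists_near_of_mem_limitSet hE h he k,
      fun h => cs.endpoint_mem_limitSet_of_near _ h⟩
  rw [this]
  refine isClosed_iInter fun k => ⟨?_⟩
  exact cs.isOpen_setOf_vertex (fun x x₀ => ¬ ∃ y ∈ E,
    cs.wordDist x y ≤ 2 * δ + cs.wordDist x₀ e) k 0

/-- Limit points of a sequence of half-spaces going to infinity and containing `z` in their limit
sets converge to `z`. -/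
theorem IsThin.mem_closure_of_far [Finite B] (hδ : cs.IsThin δ) {F : Set cs.Boundary}
    {z : cs.Boundary} (h : ∀ R : ℕ, ∃ E, cs.IsConvexSet E ∧ (∀ y ∈ E, R < cs.wordDist 1 y) ∧
      z ∈ cs.limitSet E ∧ (F ∩ cs.limitSet E).Nonempty) : z ∈ closure F := by
  choose E hE hR hz w hwF hw using h
  obtain ⟨c, c0, rfl⟩ := hδ.exists_ray_from 1 z
  choose c' c0' hc' using fun n => hδ.exists_ray_from 1 (w n)
  obtain ⟨g, hg⟩ := cs.exists_eventually_hyperfilter_eq (fun n => (c' n).vertex) 1 id (by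
    intro n i
    have := (c' n).isGeodesic 0 i (Nat.zero_le _)
    rw [c0'] at this
    simp [this])
  -- the limit ray
  let ρ : cs.GeodesicRay := ⟨g, fun i j hij => by
    obtain ⟨n, h1, h2⟩ := ((hg i).and (hg j)).exists
    rw [← h1, ← h2, (c' n).isGeodesic i j hij]⟩
  have hρ0 : ρ.vertex 0 = 1 := by
    obtain ⟨n, h1⟩ := (hg 0).exists
    exact h1.symm.trans (c0' n)
  have hρc : cs.endpoint c = cs.endpoint ρ := by
    refine cs.endpoint_eq_of_near (8 * δ) fun k => ⟨k, ?_⟩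
    obtain ⟨n, h1, h2⟩ := ((hg k).and (eventually_hyperfilter_ge (k + 2 * δ))).exists
    obtain ⟨j, hj⟩ := hδ.exists_near_of_far (hE n) (c0.trans (c0' n).symm) (hz n)
      (by rw [hc']; exact hw n) (k := k) (fun y hy => by rw [c0]; exact h2.trans_lt (hR n y hy))
    show cs.wordDist _ (g k) ≤ _
    rw [← h1]
    have e1 := c.isGeodesic 0 k (Nat.zero_le _)
    have e2 := (c' n).isGeodesic 0 j (Nat.zero_le _)
    rw [c0] at e1
    rw [c0'] at e2
    have t1 := cs.wordDist_triangle 1 (c.vertex k) ((c' n).vertex j)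
    have t2 := cs.wordDist_triangle 1 ((c' n).vertex j) (c.vertex k)
    rw [cs.wordDist_comm ((c' n).vertex j) (c.vertex k)] at t2
    have t3 := cs.wordDist_triangle (c.vertex k) ((c' n).vertex j) ((c' n).vertex k)
    have e3 : cs.wordDist ((c' n).vertex j) ((c' n).vertex k) ≤ (j - k) + (k - j) := by
      rcases le_total j k with hjk | hjk
      · rw [(c' n).isGeodesic j k hjk]; omega
      · rw [wordDist_comm, (c' n).isGeodesic k j hjk]; omega
    omega
  have hlim : Tendsto c' (hyperfilter ℕ : Filter ℕ) (𝓝 ρ) := by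
    let _ : TopologicalSpace Γ := ⊥
    have : DiscreteTopology Γ := ⟨rfl⟩
    rw [(Topology.IsInducing.mk rfl : IsInducing (GeodesicRay.vertex (cs := cs))).tendsto_nhds_iff]
    rw [tendsto_pi_nhds]
    intro i
    rw [nhds_discrete, tendsto_pure]
    exact hg i
  rw [hρc]
  refine mem_closure_of_tendsto ((cs.isQuotientMap_endpoint.continuous.tendsto ρ).comp hlim)
    (Eventually.of_forall fun n => ?_)
  simp only [Function.comp, hc']
  exact hwF n

theorem IsThin.closure_singleton [Finite B] (hδ : cs.IsThin δ) (z : cs.Boundary) :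
    closure {z} = {z} := by
  refine Set.Subset.antisymm (fun w hw => ?_) subset_closure
  by_contra hne
  -- the points of the closure of `{z}` lie in every half-space limit set containing `z`
  have h : ∀ R : ℕ, ∃ t, (∀ y ∈ cs.halfSpace t 1, R < cs.wordDist 1 y) ∧
      z ∈ cs.limitSet (cs.halfSpace t 1) ∧ w ∈ cs.limitSet (cs.halfSpace t 1) := by
    intro R
    obtain ⟨t, -, h1, h2⟩ := hδ.exists_halfSpace_far z R
    have h3 := cs.mem_limitSet_halfSpace_of_notMem h2
    rw [zero_add] at h3
    exact ⟨t, h1, h3, closure_minimal (Set.singleton_subset_iff.2 h3)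
      (hδ.isClosed_limitSet (cs.isConvexSet_halfSpace t 1)) hw⟩
  obtain ⟨L, hL⟩ := hδ.exists_joins (Ne.symm hne)
  obtain ⟨t, h1, h2, h3⟩ := h (cs.wordDist 1 (L 0) + 2 * δ)
  obtain ⟨y, hy, hd⟩ := hδ.exists_near_of_joins (cs.isConvexSet_halfSpace t 1) h2 h3 hL 0
  have := h1 y hy
  have t1 := cs.wordDist_triangle 1 (L 0) y
  omega

end Topology

/-! ### The convex hull of a set of boundary points -/

/-- The hull of `F ⊆ ∂Γ`: the vertices contained in no half-space whose limit set misses `F`. -/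
def hull (F : Set cs.Boundary) : Set Γ :=
  {x | ∀ (g : Γ) (i : B), ¬ (F ∩ cs.limitSet (g • cs.negHalfSpace i)).Nonempty →
    x ∉ g • cs.negHalfSpace i}

theorem isConvexSet_hull (F : Set cs.Boundary) : cs.IsConvexSet (cs.hull F) := by
  intro x hx y hy q hq g i hF hqg
  have hx' := hx g i hF
  have hy' := hy g i hF
  rw [smul_negHalfSpace_eq] at hqg hx' hy'
  rw [notMem_halfSpace] at hx' hy'
  exact notMem_halfSpace cs |>.2 (cs.isConvexSet_halfSpace _ _ _ hx' _ hy' _ hq) hqg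

variable {cs}

theorem smul_mem_hull {F : Set cs.Boundary} {g x : Γ} (hg : g • F = F) (hx : x ∈ cs.hull F) :
    g * x ∈ cs.hull F := by
  intro h i hF hgx
  refine hx (g⁻¹ * h) i ?_ ?_
  · rw [mul_smul, limitSet_smul]
    rintro ⟨z, hz, hz'⟩
    refine hF ⟨g • z, ?_, ?_⟩
    · rw [← hg]; exact Set.smul_mem_smul_set hz
    · exact Set.mem_inv_smul_set_iff.1 hz'
  · rw [mul_smul, Set.mem_inv_smul_set_iff]
    exact hgx

theorem Joins.mem_hull {F : Set cs.Boundary} {z w : cs.Boundary} (hz : z ∈ F) (hw : w ∈ F)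
    {L : ℤ → Γ} (hL : cs.Joins L z w) (k : ℤ) : L k ∈ cs.hull F := by
  intro g i hF hk
  rw [smul_negHalfSpace_eq] at hF hk
  rcases hL.mem_limitSet_halfSpace hk with h | h
  · exact hF ⟨z, hz, h⟩
  · exact hF ⟨w, hw, h⟩

/-- An edge of the hull crosses a wall which cuts `F`. -/
theorem wallCuts_of_mem_hull {F : Set cs.Boundary} {x : Γ} {i : B} (hx : x ∈ cs.hull F)
    (hxi : x * cs.simple i ∈ cs.hull F) : cs.WallCuts x i F := by
  constructor
  · by_contra h
    exact hx x i h (cs.mem_smul_negHalfSpace x i)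
  · by_contra h
    rw [smul_posHalfSpace] at h
    exact hxi _ i h (cs.mem_smul_negHalfSpace _ i)

/-- If the reflections along the walls cutting `F` preserve `F`, the hull of `F` is a coset of a
special subgroup, namely the one generated by the labels of the edges of the hull at `x`. -/
theorem inv_mul_mem_specialSubgroup_of_mem_hull {F : Set cs.Boundary}
    (hF : ∀ (g : Γ) (i : B), cs.WallCuts g i F → cs.wallReflection g i • F = F) {x y : Γ}
    (hx : x ∈ cs.hull F) (hy : y ∈ cs.hull F) :
    x⁻¹ * y ∈ cs.specialSubgroup {i | x * cs.simple i ∈ cs.hull F} := by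
  -- conjugates by `x` of elements of the special subgroup preserve `F`
  have hstab : ∀ u ∈ cs.specialSubgroup {i | x * cs.simple i ∈ cs.hull F},
      (x * u * x⁻¹) • F = F := by
    intro u hu
    have hle : (cs.specialSubgroup {i | x * cs.simple i ∈ cs.hull F}).map
        (MulAut.conj x).toMonoidHom ≤ MulAction.stabilizer Γ F := by
      rw [specialSubgroup, MonoidHom.map_closure, Subgroup.closure_le]
      rintro _ ⟨_, ⟨i, hi, rfl⟩, rfl⟩
      exact hF x i (wallCuts_of_mem_hull hx hi)
    exact hle ⟨u, hu, rfl⟩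
  obtain ⟨p, hp0, hp1, hp⟩ := cs.exists_isGeodesicSegment x y
  have key : ∀ n ≤ cs.wordDist x y,
      x⁻¹ * p n ∈ cs.specialSubgroup {i | x * cs.simple i ∈ cs.hull F} := by
    intro n
    induction n with
    | zero => intro _; rw [hp0, inv_mul_cancel]; exact one_mem _
    | succ n ih =>
      intro hn
      have hu := ih (by omega)
      have hd := hp n (n + 1) (by omega) hn
      rw [Nat.add_sub_cancel_left, wordDist, length_eq_one_iff] at hd
      obtain ⟨i, hi⟩ := hd
      rw [inv_mul_eq_iff_eq_mul] at hi
      rw [hi, ← mul_assoc]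
      refine mul_mem hu (Subgroup.subset_closure ⟨i, ?_, rfl⟩)
      have hmem : p (n + 1) ∈ cs.hull F :=
        cs.isConvexSet_hull F x hx y hy _
          (IsGeodesicSegment.between cs ⟨hp0, hp1, hp⟩ hn)
      have := smul_mem_hull (hstab _ (inv_mem hu)) hmem
      rw [hi] at this
      simpa [mul_assoc] using this
  have := key _ le_rfl
  rwa [hp1] at this

/-! ### Sets invariant under the reflections whose walls cut them -/

variable {δ : ℕ}

theorem cuttingSubgroup_le_stabilizer {F : Set cs.Boundary}
    (hF : ∀ (g : Γ) (i : B), cs.WallCuts g i F → cs.wallReflection g i • F = F) :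
    cs.cuttingSubgroup F ≤ MulAction.stabilizer Γ F := by
  rw [cuttingSubgroup, Subgroup.closure_le]
  rintro _ ⟨g, i, h, rfl⟩
  exact hF g i h

theorem map_conj_specialSubgroup_le_cuttingSubgroup {F : Set cs.Boundary} {x : Γ}
    (hx : x ∈ cs.hull F) :
    (cs.specialSubgroup {i | x * cs.simple i ∈ cs.hull F}).map (MulAut.conj x).toMonoidHom
      ≤ cs.cuttingSubgroup F := by
  rw [specialSubgroup, MonoidHom.map_closure, Subgroup.closure_le]
  rintro _ ⟨_, ⟨i, hi, rfl⟩, rfl⟩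
  exact Subgroup.subset_closure ⟨x, i, wallCuts_of_mem_hull hx hi, rfl⟩

theorem mem_map_conj_specialSubgroup_of_smul_eq {F : Set cs.Boundary}
    (hF : ∀ (g : Γ) (i : B), cs.WallCuts g i F → cs.wallReflection g i • F = F) {x g : Γ}
    (hx : x ∈ cs.hull F) (hg : g • F = F) :
    g ∈ (cs.specialSubgroup {i | x * cs.simple i ∈ cs.hull F}).map
      (MulAut.conj x).toMonoidHom := by
  refine ⟨x⁻¹ * (g * x), inv_mul_mem_specialSubgroup_of_mem_hull hF hx (smul_mem_hull hg hx), ?_⟩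
  simp [mul_assoc]

/-- The hull of `F` is an orbit of the group generated by the cutting reflections, whence
this group is parabolic, contains every element preserving `F`, and has the limit set of the hull.
For the density of `F` in this limit set, a line joining two points of `F` is moved by the group so as
to meet a given small half-space around a limit point; one of its ends lies in this half-space. -/
theorem IsThin.parabolic_of_invariant [Finite B] (hδ : cs.IsThin δ) {F : Set cs.Boundary}
    (hnt : F.Nontrivial)
    (hF : ∀ (g : Γ) (i : B), cs.WallCuts g i F → cs.wallReflection g i • F = F) :
    cs.IsParabolic (cs.cuttingSubgroup F) ∧
      closure F = cs.limitSet (cs.cuttingSubgroup F) ∧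
      cs.cuttingSubgroup F = MulAction.stabilizer Γ F := by
  have hle := cuttingSubgroup_le_stabilizer hF
  obtain ⟨a, ha, b, hb, hab⟩ := hnt
  obtain ⟨L, hL⟩ := hδ.exists_joins hab
  have hx : L 0 ∈ cs.hull F := hL.mem_hull ha hb 0
  have hstab : MulAction.stabilizer Γ F ≤ cs.cuttingSubgroup F := fun g hg =>
    map_conj_specialSubgroup_le_cuttingSubgroup hx
      (mem_map_conj_specialSubgroup_of_smul_eq hF hx hg)
  -- the hull is an orbit of the cutting subgroup
  have hull_orbit : ∀ y ∈ cs.hull F, y * (L 0)⁻¹ ∈ cs.cuttingSubgroup F := by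
    intro y hy
    refine map_conj_specialSubgroup_le_cuttingSubgroup hx
      ⟨_, inv_mul_mem_specialSubgroup_of_mem_hull hF hx hy, ?_⟩
    simp
  have hdist : ∀ y, cs.wordDist (y * (L 0)⁻¹) y = cs.length (L 0) := by
    intro y
    rw [wordDist_comm, wordDist, inv_mul_cancel_left, length_inv]
  have hlim : cs.limitSet (cs.cuttingSubgroup F) = cs.limitSet (cs.hull F) := by
    refine Set.Subset.antisymm (cs.limitSet_subset_of_near (cs.length (L 0)) fun p hp => ?_)
      (cs.limitSet_subset_of_near (cs.length (L 0)) fun y hy => ?_)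
    · refine ⟨p * L 0, smul_mem_hull (hle hp) hx, ?_⟩
      have := hdist (p * L 0)
      rw [mul_inv_cancel_right] at this
      exact this.le
    · exact ⟨_, hull_orbit y hy, by rw [wordDist_comm]; exact (hdist y).le⟩
  refine ⟨⟨{i | L 0 * cs.simple i ∈ cs.hull F}, L 0, ?_, ?_⟩, ?_, le_antisymm hle hstab⟩
  · by_contra hJ
    rw [Set.not_nonempty_iff_eq_empty] at hJ
    have h1 := inv_mul_mem_specialSubgroup_of_mem_hull hF hx (hL.mem_hull ha hb 1)
    rw [hJ, specialSubgroup, Set.image_empty, Subgroup.closure_empty, Subgroup.mem_bot] at h1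
    have h2 := hL.1 0 1 (by omega)
    rw [wordDist, h1, length_one] at h2
    omega
  · exact le_antisymm
      (fun g hg => mem_map_conj_specialSubgroup_of_smul_eq hF hx (hle hg))
      (map_conj_specialSubgroup_le_cuttingSubgroup hx)
  · rw [hlim]
    refine Set.Subset.antisymm (closure_minimal (fun z hz => ?_)
      (hδ.isClosed_limitSet (cs.isConvexSet_hull F))) fun z hz => ?_
    · obtain ⟨w, hw, hzw⟩ : ∃ w ∈ F, z ≠ w := by
        by_cases h : z = a
        · exact ⟨b, hb, h ▸ hab⟩
        · exact ⟨a, ha, h⟩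
      obtain ⟨L', hL'⟩ := hδ.exists_joins hzw
      obtain ⟨ρ, hρ, rfl⟩ := hL'.2.1
      refine cs.endpoint_mem_limitSet_of_eventually 0 fun n _ => ?_
      rw [hρ]
      exact hL'.mem_hull hz hw _
    · refine hδ.mem_closure_of_far fun R => ?_
      obtain ⟨t, -, h1, h2⟩ := hδ.exists_halfSpace_far z R
      have h3 := cs.mem_limitSet_halfSpace_of_notMem h2
      rw [zero_add] at h3
      refine ⟨_, cs.isConvexSet_halfSpace t 1, h1, h3, ?_⟩
      -- a vertex of the hull in the half-space, and the translate of `L` through it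
      obtain ⟨y, hy, hyt⟩ : ∃ y ∈ cs.hull F, y ∈ cs.halfSpace t 1 := by
        by_contra! h
        refine h2 (cs.limitSet_mono (fun y hy => ?_) hz)
        have := h y hy
        rwa [notMem_halfSpace] at this
      have hg := hle (hull_orbit y hy)
      have hLg := hL.smul (y * (L 0)⁻¹)
      have hmem : ∀ u ∈ F, (y * (L 0)⁻¹) • u ∈ F := fun u hu =>
        (MulAction.mem_stabilizer_iff.1 hg).subset (Set.smul_mem_smul_set hu)
      rcases hLg.mem_limitSet_halfSpace (k := 0) (t := t) (a := 1) (by simpa using hyt) with h | h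
      · exact ⟨_, hmem a ha, h⟩
      · exact ⟨_, hmem b hb, h⟩

/-! ### Invariant equivalence relations and folding -/

theorem WallCuts.halfSpace {g : Γ} {i : B} {F : Set cs.Boundary} (h : cs.WallCuts g i F)
    (a : ZMod 2) : (F ∩ cs.limitSet (cs.halfSpace (cs.wallReflection g i) a)).Nonempty := by
  obtain ⟨h1, h2⟩ := h
  rw [smul_negHalfSpace_eq] at h1
  rw [smul_posHalfSpace_eq] at h2
  by_cases ha : a = cs.side (cs.wallReflection g i) g
  · rwa [ha]
  · rwa [zmod_two_ne_iff.1 ha]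

theorem IsReflection.exists_wallCuts {t : Γ} (ht : cs.IsReflection t) {F : Set cs.Boundary}
    (h : ∀ a, (F ∩ cs.limitSet (cs.halfSpace t a)).Nonempty) :
    ∃ g i, cs.WallCuts g i F ∧ t = cs.wallReflection g i := by
  obtain ⟨g, i, rfl⟩ := ht
  refine ⟨g, i, ⟨?_, ?_⟩, rfl⟩
  · rw [smul_negHalfSpace_eq]; exact h _
  · rw [smul_posHalfSpace_eq]; exact h _

/-- A wall cutting a connected coset has in its limit set a point of the coset, which the reflection
fixes; so the reflection preserves the coset. -/
theorem IsThin.smul_class_eq (hδ : cs.IsThin δ) (r : Setoid cs.Boundary)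
    (hr : ∀ (g : Γ) (z w : cs.Boundary), r z w → r (g • z) (g • w)) {F : Set cs.Boundary}
    (hF : F ∈ r.classes) (hconn : IsPreconnected F) {g : Γ} {i : B} (h : cs.WallCuts g i F) :
    cs.wallReflection g i • F = F := by
  have ht := cs.isReflection_wallReflection g i
  have hcl : ∀ a, IsClosed (cs.limitSet (cs.halfSpace (cs.wallReflection g i) a)) := fun a =>
    hδ.isClosed_limitSet (cs.isConvexSet_halfSpace _ a)
  obtain ⟨u, huF, hu0, hu1⟩ := isPreconnected_closed_iff.1 hconn _ _ (hcl 0) (hcl (0 + 1))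
    (by rw [limitSet_halfSpace_union]; exact Set.subset_univ F) (h.halfSpace 0) (h.halfSpace _)
  have hfix : cs.wallReflection g i • u = u := hδ.smul_eq_of_mem_limitSet ht fun a => by
    rcases zmod_two_eq a with rfl | rfl
    · exact hu0
    · exact hu1
  obtain ⟨y, rfl⟩ := hF
  have hsub : ∀ x, r x y → r (cs.wallReflection g i • x) y := by
    intro x hx
    have h1 := hr (cs.wallReflection g i) x u (r.trans hx (r.symm huF))
    rw [hfix] at h1
    exact r.trans h1 huF
  refine Set.Subset.antisymm ?_ fun x hx => ⟨_, hsub x hx, ?_⟩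
  · rintro _ ⟨x, hx, rfl⟩
    exact hsub x hx
  · simp only [smul_smul, ht.mul_self, one_smul]

variable (cs) in
open scoped Classical in
/-- The folding of the boundary onto the limit set of the side `1` of the wall of `t`. -/
noncomputable def boundaryFold (t : Γ) (z : cs.Boundary) : cs.Boundary :=
  if z ∈ cs.limitSet (cs.halfSpace t 1) then z else t • z

theorem IsThin.continuous_boundaryFold (hδ : cs.IsThin δ) {t : Γ} (ht : cs.IsReflection t) :
    Continuous (cs.boundaryFold t) := by
  classical
  have hcl : ∀ a, IsClosed (cs.limitSet (cs.halfSpace t a)) := fun a =>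
    hδ.isClosed_limitSet (cs.isConvexSet_halfSpace _ a)
  refine continuous_id.if (fun z hz => ?_) (cs.continuous_boundary_smul t)
  refine (hδ.smul_eq_of_mem_limitSet ht fun a => ?_).symm
  rw [frontier_eq_closure_inter_closure] at hz
  rcases zmod_two_eq a with rfl | rfl
  · exact closure_minimal (fun w hw => cs.mem_limitSet_halfSpace_of_notMem (a := 1) hw)
      (hcl (1 + 1)) hz.2
  · exact closure_minimal (fun w hw => hw) (hcl 1) hz.1

theorem boundaryFold_mem_limitSet {t : Γ} (ht : cs.IsReflection t) (z : cs.Boundary) :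
    cs.boundaryFold t z ∈ cs.limitSet (cs.halfSpace t 1) := by
  unfold boundaryFold
  split_ifs with h
  · exact h
  · have h1 := cs.mem_limitSet_halfSpace_of_notMem h
    have h2 : t • cs.halfSpace t (1 + 1) ⊆ cs.halfSpace t 1 := by
      rintro _ ⟨x, hx, rfl⟩
      rw [mem_halfSpace] at hx
      show cs.side t (t * x) = 1
      rw [cs.side_reflection_mul ht, hx]
      decide
    refine cs.limitSet_mono h2 ?_
    rw [limitSet_smul]
    exact Set.smul_mem_smul_set h1

/-- Points of `F` strictly inside a half-space, joined by a path in `F`, are joined by a path in `F`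
within the limit set of the half-space: fold the path. -/
theorem IsThin.joinedIn_inter_limitSet (hδ : cs.IsThin δ) {F : Set cs.Boundary}
    (hF : ∀ (g : Γ) (i : B), cs.WallCuts g i F → cs.wallReflection g i • F = F)
    {t : Γ} (ht : cs.IsReflection t) {u v : cs.Boundary} (huv : JoinedIn F u v)
    (hu : u ∉ cs.limitSet (cs.halfSpace t 0)) (hv : v ∉ cs.limitSet (cs.halfSpace t 0)) :
    JoinedIn (F ∩ cs.limitSet (cs.halfSpace t 1)) u v := by
  have hu1 := cs.mem_limitSet_halfSpace_of_notMem hu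
  have hv1 := cs.mem_limitSet_halfSpace_of_notMem hv
  rw [zero_add] at hu1 hv1
  have hfold : ∀ z ∈ F, cs.boundaryFold t z ∈ F := by
    intro z hz
    unfold boundaryFold
    split_ifs with h
    · exact hz
    · obtain ⟨g, i, hcut, rfl⟩ := ht.exists_wallCuts (F := F) fun a => by
        rcases zmod_two_eq a with rfl | rfl
        · exact ⟨z, hz, cs.mem_limitSet_halfSpace_of_notMem (a := 1) h⟩
        · exact ⟨u, huv.source_mem, hu1⟩
      rw [← hF g i hcut]
      exact Set.smul_mem_smul_set hz
  obtain ⟨γ, hγ⟩ := huv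
  refine ⟨(γ.map (hδ.continuous_boundaryFold ht)).cast (if_pos hu1).symm (if_pos hv1).symm,
    fun s => ⟨hfold _ (hγ s), boundaryFold_mem_limitSet ht _⟩⟩

/-- Limit sets of half-spaces far from the identity are small. -/
theorem IsThin.exists_forall_visual_lt [Finite B] (hδ : cs.IsThin δ)
    {d : cs.Boundary → cs.Boundary → ℝ} (hd : cs.IsVisualMetric d) {ε : ℝ} (hε : 0 < ε) :
    ∃ R : ℕ, ∀ E, cs.IsConvexSet E → (∀ y ∈ E, R < cs.wordDist 1 y) →
      ∀ u ∈ cs.limitSet E, ∀ v ∈ cs.limitSet E, d u v < ε := by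
  obtain ⟨a, C, ha, hC, h⟩ := hd.visual
  obtain ⟨N, hN⟩ := pow_unbounded_of_one_lt (C / ε) ha
  refine ⟨N + 2 * δ, fun E hE hR u hu v hv => ?_⟩
  by_cases huv : u = v
  · rw [(hd.eq_zero_iff u v).2 huv]; exact hε
  obtain ⟨L, hL⟩ := hδ.exists_joins huv
  have hℓ : N ≤ cs.distToLine L := by
    obtain ⟨n, hn⟩ := Nat.sInf_mem (Set.range_nonempty fun n => cs.wordDist 1 (L n))
    rw [distToLine, ← hn]
    obtain ⟨y, hy, hdy⟩ := hδ.exists_near_of_joins hE hu hv hL n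
    have := hR y hy
    have t1 := cs.wordDist_triangle 1 (L n) y
    simp only
    omega
  refine (h u v L hL).2.trans_lt ?_
  have h1 : a ^ N ≤ a ^ cs.distToLine L := pow_le_pow_right₀ ha.le hℓ
  have h2 : 0 < a ^ cs.distToLine L := pow_pos (by linarith) _
  rw [← div_eq_mul_inv, div_lt_iff₀ h2]
  rw [div_lt_iff₀ hε] at hN
  nlinarith


/-- Approximation of paths in the closure of `F` by paths in `F`: subdivide the path finely enough
for each piece to lie strictly inside a small half-space, and join nearby points of `F` within these
half-spaces. -/
theorem IsThin.exists_path_approx [Finite B] (hδ : cs.IsThin δ)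
    {d : cs.Boundary → cs.Boundary → ℝ} (hd : cs.IsVisualMetric d) {F : Set cs.Boundary}
    (hF : ∀ (g : Γ) (i : B), cs.WallCuts g i F → cs.wallReflection g i • F = F)
    (hpc : IsPathConnected F) {ε : ℝ} (hε : 0 < ε) (η : C(I, cs.Boundary))
    (hη : ∀ s, η s ∈ closure F) :
    ∃ η' : C(I, cs.Boundary), (∀ s, η' s ∈ F) ∧ ∀ s, d (η s) (η' s) < ε := by
  obtain ⟨R, hR⟩ := hδ.exists_forall_visual_lt hd hε
  choose t ht htR htη using fun s => hδ.exists_halfSpace_far (η s) R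
  set O : I → Set cs.Boundary := fun s => (cs.limitSet (cs.halfSpace (t s) 0))ᶜ with hO
  have hOopen : ∀ s, IsOpen (O s) := fun s =>
    (hδ.isClosed_limitSet (cs.isConvexSet_halfSpace (t s) 0)).isOpen_compl
  obtain ⟨ρ, hρ, hball⟩ := lebesgue_number_lemma_of_metric (isCompact_univ (X := I))
    (fun s => (hOopen s).preimage η.continuous) fun s _ => Set.mem_iUnion.2 ⟨s, htη s⟩
  obtain ⟨N, hN⟩ := exists_nat_one_div_lt hρ
  have hN0 : (0 : ℝ) < N + 1 := by positivity
  -- the subdivision points, and the half-spaces chosen around them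
  set p : ℕ → I := fun k => Set.projIcc 0 1 zero_le_one ((k : ℝ) / (N + 1)) with hp
  choose q hq using fun k => hball (p k) (Set.mem_univ _)
  have hpp : ∀ k, dist (p k) (p (k - 1)) < ρ := by
    intro k
    refine lt_of_le_of_lt ?_ hN
    rw [Subtype.dist_eq, Real.dist_eq]
    refine (Set.abs_projIcc_sub_projIcc zero_le_one).trans ?_
    rw [← sub_div, abs_div, abs_of_pos hN0]
    refine div_le_div_of_nonneg_right ?_ hN0.le
    cases k with
    | zero => simp
    | succ k => simp
  have hz : ∀ k, ∃ z ∈ F, z ∈ O (q k) ∧ z ∈ O (q (k - 1)) := by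
    intro k
    have h1 : η (p k) ∈ O (q k) := hq k (Metric.mem_ball_self hρ)
    have h2 : η (p k) ∈ O (q (k - 1)) := hq (k - 1) (hpp k)
    obtain ⟨z, hz, hzF⟩ := mem_closure_iff.1 (hη (p k)) _
      ((hOopen (q k)).inter (hOopen (q (k - 1)))) ⟨h1, h2⟩
    exact ⟨z, hzF, hz⟩
  choose z hzF hz0 hz1 using hz
  obtain ⟨f, hf, -, hfV⟩ := exists_continuous_of_forall_joinedIn z
    (fun k => F ∩ cs.limitSet (cs.halfSpace (t (q k)) 1))
    (fun k => hδ.joinedIn_inter_limitSet hF (ht (q k)) (hpc.joinedIn _ (hzF k) _ (hzF (k + 1)))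
      (hz0 k) (hz1 (k + 1))) (N + 2)
  have key : ∀ s : I, ∃ k, f ((N + 1) * s) ∈ F ∩ cs.limitSet (cs.halfSpace (t (q k)) 1) ∧
      η s ∈ O (q k) := by
    intro s
    have hs0 : (0 : ℝ) ≤ (N + 1) * s := mul_nonneg hN0.le s.2.1
    have h1 := Nat.floor_le hs0
    have h2 := (Nat.lt_floor_add_one ((N + 1) * (s : ℝ))).le
    set k := ⌊(N + 1) * (s : ℝ)⌋₊ with hk
    refine ⟨k, hfV k ?_ _ h1 h2, hq k ?_⟩
    · have : (k : ℝ) < N + 2 := by nlinarith [s.2.2]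
      exact_mod_cast this
    · rw [Metric.mem_ball]
      refine lt_of_le_of_lt ?_ hN
      rw [Subtype.dist_eq, Real.dist_eq]
      have h3 : ((Set.projIcc (0 : ℝ) 1 zero_le_one s : I) : ℝ) = s := by simp
      rw [← h3]
      refine (Set.abs_projIcc_sub_projIcc zero_le_one).trans ?_
      have h4 : (s : ℝ) - k / (N + 1) = ((N + 1) * s - k) / (N + 1) := by field_simp
      rw [h4, abs_div, abs_of_pos hN0, abs_of_nonneg (by linarith)]
      exact div_le_div_of_nonneg_right (by linarith) hN0.le
  refine ⟨⟨fun s => f ((N + 1) * s), hf.comp (continuous_const.mul continuous_subtype_val)⟩,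
    fun s => ?_, fun s => ?_⟩
  · obtain ⟨k, h1, -⟩ := key s
    exact h1.1
  · obtain ⟨k, h1, h2⟩ := key s
    have h3 := cs.mem_limitSet_halfSpace_of_notMem h2
    rw [zero_add] at h3
    exact hR _ (cs.isConvexSet_halfSpace _ 1) (htR (q k)) _ h3 _ h1.2

end CoxeterSystem

theorem mainTheorem5 {B Γ : Type*} [Finite B] [Group Γ] {M : CoxeterMatrix B}
    (cs : CoxeterSystem M Γ) (hΓ : cs.IsGromovHyperbolic) :
    -- subsets invariant under the reflections whose walls cut them
    (∀ F : Set cs.Boundary, F.Nontrivial →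
      (∀ (g : Γ) (i : B), cs.WallCuts g i F → cs.wallReflection g i • F = F) →
        cs.IsParabolic (cs.cuttingSubgroup F) ∧
        closure F = cs.limitSet (cs.cuttingSubgroup F) ∧
        cs.cuttingSubgroup F = MulAction.stabilizer Γ F) ∧
    -- invariant equivalence relations with connected cosets
    (∀ r : Setoid cs.Boundary,
      (∀ (g : Γ) (z w : cs.Boundary), r z w → r (g • z) (g • w)) →
      (∀ F ∈ r.classes, IsConnected F) →
        (∀ F ∈ r.classes, (∃ z, closure F = {z}) ∨ cs.IsParabolicLimitSet (closure F)) ∧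
        (∀ d : cs.Boundary → cs.Boundary → ℝ, cs.IsVisualMetric d →
          ∀ F ∈ r.classes, F.Nontrivial → IsPathConnected F →
          ∀ P : Subgroup Γ, cs.IsParabolic P → closure F = cs.limitSet P →
          ∀ ε : ℝ, 0 < ε → ∀ η : C(I, cs.Boundary), (∀ t, η t ∈ cs.limitSet P) →
            ∃ η' : C(I, cs.Boundary), (∀ t, η' t ∈ F) ∧ ∀ t, d (η t) (η' t) < ε)) := by
  obtain ⟨δ, hδ⟩ := hΓ.exists_isThin
  refine ⟨fun F hnt hF => hδ.parabolic_of_invariant hnt hF, fun r hr hconn => ?_⟩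
  have hinv : ∀ F ∈ r.classes, ∀ (g : Γ) (i : B), cs.WallCuts g i F →
      cs.wallReflection g i • F = F := fun F hF g i h =>
    hδ.smul_class_eq r hr hF (hconn F hF).isPreconnected h
  refine ⟨fun F hF => ?_, fun d hd F hF _ hpc P _ hcl ε hε η hη => ?_⟩
  · rcases (hconn F hF).nonempty.exists_eq_singleton_or_nontrivial with ⟨z, rfl⟩ | hnt
    · exact Or.inl ⟨z, hδ.closure_singleton z⟩
    · obtain ⟨h1, h2, -⟩ := hδ.parabolic_of_invariant hnt (hinv F hF)
      exact Or.inr ⟨hnt.nonempty.closure, _, h1, h2⟩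
  · exact hδ.exists_path_approx hd (hinv F hF) hpc hε η fun s => hcl ▸ hη s
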